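/- **Conventions.** On $\mathbb R^2\ni x=(x_0,x_1)$ with the Euclidean metric let $x\ll y$ iff $|y_1-x_1|<y_0-x_0$ and $x\le y$ iff $|y_1-x_1|\le y_0-x_0$. For $p\in[1,\infty)$ let $\tau^p(x,y)=|y-x|^p$, where $|v|^p=(|v_0|^p-|v_1|^p)^{1/p}$ if $|v_0|^p\ge|v_1|^p$ and $v_0>0$, and $|v|^p=0$ otherwise; let $\tau^\infty$ be the pointwise limit of $\tau^p$ as $p\to\infty$, i.e. $\tau^\infty(x,y)=y_0-x_0$ if $x\ll y$ and $0$ otherwise. The Lorentzian $L^p$ plane $(\mathbb R^{1,1},\tau^p)$ is $\mathbb R^2$ with $\ll,\le,\tau^p$. A *distance realizer* from $x$ to $y$ is a Lipschitz curve $\gamma:[0,1]\to\mathbb R^2$ from $x$ to $y$ with $\gamma(s)\le\gamma(t)$ for $s<t$ whose length $\inf\sum_i\tau(\gamma(t_i),\gamma(t_{i+1}))$ (infimum over all partitions of $[0,1]$) equals $\tau(x,y)$. A *timelike triangle* $abc$ in $U$ consists of points $a\ll b\ll c$ and distance realizers $ab$, $bc$, $ac$ contained in $U$. For $K\in\mathbb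 R$ let $(\mathcal S_K,\bar\tau)$ be the simply connected two-dimensional Lorentzian model space of constant curvature $K$ (the universal cover of scaled de Sitter space for $K>0$, the Minkowski plane for $K=0$, the universal cover of scaled anti-de Sitter space for $K<0$). A *comparison triangle* of $abc$ is a triangle $\bar a\bar b\bar c$ in $\mathcal S_K$ with the same three time separations; the *comparison point* $\bar q$ of a point $q$ on a side $xy$ is the point $\bar x\le\bar q\le\bar y$ with $\bar\tau(\bar x,\bar q)=\tau(x,q)$ and $\bar\tau(\bar q,\bar y)=\tau(q,y)$. The space has timelike sectional curvature *bounded below (above) by $K$ at a point $x$* if $x$ has a neighbourhood $U$ such that for every timelike triangle $abc$ in $U$ (with $\tau(a,c)<\pi/\sqrt{-K}$ if $K<0$), every point $M$ on the side $bc$, and all comparison triangles $\bar a\bar b\bar c$ in $\mathcal S_K$ with comparison point $\bar M$ one has $\tau(a,M)\le\bar\tau(\bar a,\bar M)$ (respectively $\ge$). It is *flat* if it has curvature bounded below and above by $0$ at every point. **Lemma.** 1. For every $p\in[1,\infty)$ with $p\ne2$, every point $x\in\mathbb R^{1,1}$ and every $K\in\mathbb R$, the plane $(\mathbb R^{1,1},\tau^p)$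 has timelike sectional curvature neither bounded below by $K$ at $x$ nor bounded above by $K$ at $x$. 2. $(\mathbb R^{1,1},\tau^2)$ is flat. It is even flat in the following strong sense: every point has an open neighbourhood $U$ such that $\tau^2$ is finite and continuous on $U\times U$, any $y\ll z$ in $U$ are joined by a distance realizer in $U$, and for every timelike triangle in $U$ with comparison triangle in the Minkowski plane one has $\tau^2(q,r)=\bar\tau(\bar q,\bar r)$ for all points $q,r$ on its sides. 3. $(\mathbb R^{1,1},\tau^\infty)$ is flat. -/

import Mathlib

open Real Set Filter Topology
open scoped ENNReal

noncomputable section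

/-- The plane `ℝ²` with coordinates `x 0` (time) and `x 1` (space) and the Euclidean metric. -/
abbrev Plane : Type := EuclideanSpace ℝ (Fin 2)

/-- The data `(≪, ≤, τ)` of a causal space with a time separation function. -/
structure LorentzianData (X : Type*) where
  /-- the timelike relation `x ≪ y` -/
  ll : X → X → Prop
  /-- the causal relation `x ≤ y` -/
  le : X → X → Prop
  /-- the time separation function -/
  tau : X → X → ℝ≥0∞

/-! ### The Lorentzian `L^p` planes -/

/-- `x ≪ y` in the Minkowski plane. -/
def MinkowskiLL (x y : Plane) : Prop := |y 1 - x 1| < y 0 - x 0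

/-- `x ≤ y` in the Minkowski plane. -/
def MinkowskiLE (x y : Plane) : Prop := |y 1 - x 1| ≤ y 0 - x 0

open Classical in
/-- The Lorentzian `L^p` "norm" for finite `p`. -/
def lorentzNorm (p : ℝ) (v : Plane) : ℝ :=
  if |v 1| ^ p ≤ |v 0| ^ p ∧ 0 < v 0 then (|v 0| ^ p - |v 1| ^ p) ^ (1 / p) else 0

open Classical in
/-- The Lorentzian `L^∞` "norm". It is the pointwise limit of the `L^p` ones, see
`tendsto_lorentzNorm`. -/
def lorentzNormInf (v : Plane) : ℝ := if |v 1| < v 0 then v 0 else 0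

theorem tendsto_lorentzNorm (v : Plane) :
    Tendsto (fun p : ℝ => lorentzNorm p v) atTop (𝓝 (lorentzNormInf v)) := by
  unfold lorentzNormInf
  split_ifs with h
  · have h0 : 0 < v 0 := lt_of_le_of_lt (abs_nonneg _) h
    have hinv : Tendsto (fun p : ℝ => 1 / p) atTop (𝓝 0) := by
      simpa only [one_div] using tendsto_inv_atTop_zero (𝕜 := ℝ)
    have hr : Tendsto (fun p : ℝ => 1 - (|v 1| / v 0) ^ p) atTop (𝓝 (1 - 0)) :=
      tendsto_const_nhds.sub (tendsto_rpow_atTop_of_base_lt_one _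
        (by have : 0 ≤ |v 1| / v 0 := by positivity
            linarith) ((div_lt_one h0).2 h))
    have key := (hr.rpow hinv (Or.inl (by norm_num))).const_mul (v 0)
    simp only [sub_zero, rpow_zero, mul_one] at key
    refine key.congr' ?_
    filter_upwards [eventually_gt_atTop 0] with p hp
    have hle : |v 1| ^ p ≤ v 0 ^ p := rpow_le_rpow (abs_nonneg _) h.le hp.le
    have hpos : 0 < v 0 ^ p := rpow_pos_of_pos h0 p
    rw [lorentzNorm, abs_of_pos h0, if_pos ⟨hle, h0⟩, div_rpow (abs_nonneg _) h0.le]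
    have : v 0 ^ p - |v 1| ^ p = v 0 ^ p * (1 - |v 1| ^ p / v 0 ^ p) := by
      field_simp
    rw [this, mul_rpow hpos.le (sub_nonneg.2 ((div_le_one hpos).2 hle)), ← rpow_mul h0.le,
      mul_one_div_cancel hp.ne', rpow_one]
  · refine tendsto_const_nhds.congr' ?_
    filter_upwards [eventually_gt_atTop 0] with p hp
    rw [lorentzNorm]
    split_ifs with h2
    · obtain ⟨h3, h4⟩ := h2
      rw [abs_of_pos h4] at h3 ⊢
      have h5 : v 0 ^ p ≤ |v 1| ^ p := rpow_le_rpow h4.le (not_lt.1 h) hp.le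
      rw [le_antisymm h3 h5, sub_self, zero_rpow (one_div_pos.2 hp).ne']
    · rfl

/-- `(ℝ^{1,1}, τ^p)` for finite `p`, with the causal relations of the Minkowski plane. -/
def lpPlane (p : ℝ) : LorentzianData Plane where
  ll := MinkowskiLL
  le := MinkowskiLE
  tau x y := ENNReal.ofReal (lorentzNorm p (y - x))

/-- `(ℝ^{1,1}, τ^∞)`, with the causal relations of the Minkowski plane. -/
def lpPlaneInf : LorentzianData Plane where
  ll := MinkowskiLL
  le := MinkowskiLE
  tau x y := ENNReal.ofReal (lorentzNormInf (y - x))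

/-! ### The two-dimensional Lorentzian model spaces of constant curvature `K`

All of them are simply connected and are described by global coordinates on `ℝ²`:
* `K = 0`: the Minkowski plane, metric `-dt² + dx²`, point `(t, x)`;
* `K > 0`: the universal cover of the de Sitter space `{-X₀² + X₁² + X₂² = 1/K}`; the point `(t, φ)`
  lies over `(sinh t, cosh t cos φ, cosh t sin φ) / √K`, metric `(-dt² + cosh² t dφ²) / K`;
* `K < 0`: the universal cover of the anti-de Sitter space `{-X₀² - X₁² + X₂² = 1/K}`; the point
  `(t, r)` lies over `(cosh r cos t, cosh r sin t, sinh r) / √(-K)`,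
  metric `(-cosh² r dt² + dr²) / (-K)`. -/

/-- The Gudermannian function `s ↦ ∫₀ˢ du / cosh u`. -/
def gudermann (s : ℝ) : ℝ := arctan (sinh s)

/-- The time coordinate of a conformal embedding of the model space into the Minkowski plane. -/
def confTime (K : ℝ) (x : Plane) : ℝ := if 0 < K then gudermann (x 0) else x 0

/-- The space coordinate of a conformal embedding of the model space into the Minkowski plane. -/
def confSpace (K : ℝ) (x : Plane) : ℝ := if K < 0 then gudermann (x 1) else x 1

/-- `K` times the ambient scalar product of two points of the de Sitter space (`K > 0`). -/
def deSitterProd (x y : Plane) : ℝ :=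
  cosh (x 0) * cosh (y 0) * cos (y 1 - x 1) - sinh (x 0) * sinh (y 0)

/-- `K` times the ambient scalar product of two points of the anti-de Sitter space (`K < 0`). -/
def antiDeSitterProd (x y : Plane) : ℝ :=
  cosh (x 1) * cosh (y 1) * cos (y 0 - x 0) - sinh (x 1) * sinh (y 1)

/-- `x ≪ y` in the model space of curvature `K`. -/
def ModelLL (K : ℝ) (x y : Plane) : Prop :=
  |confSpace K y - confSpace K x| < confTime K y - confTime K x

/-- `x ≤ y` in the model space of curvature `K`. -/
def ModelLE (K : ℝ) (x y : Plane) : Prop :=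
  |confSpace K y - confSpace K x| ≤ confTime K y - confTime K x

open Classical in
/-- The time separation of the model space of curvature `K`. In the anti-de Sitter case it is infinite
as soon as there are timelike curves from `x` to `y` that come arbitrarily close to infinity. -/
def modelTau (K : ℝ) (x y : Plane) : ℝ≥0∞ :=
  if ModelLL K x y then
    if 0 < K then ENNReal.ofReal (arcosh (deSitterProd x y) / √K)
    else if K < 0 then
      if confTime K y - confTime K x ≤ π - |confSpace K x + confSpace K y| then
        ENNReal.ofReal (arccos (antiDeSitterProd x y) / √(-K))
      else ⊤
    else ENNReal.ofReal √((y 0 - x 0) ^ 2 - (y 1 - x 1) ^ 2)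
  else 0

/-- The simply connected two-dimensional Lorentzian model space of constant curvature `K`. -/
def modelSpace (K : ℝ) : LorentzianData Plane where
  ll := ModelLL K
  le := ModelLE K
  tau := modelTau K

/-- The bound on the longest side of triangles that are compared with the model space. -/
def modelDiam (K : ℝ) : ℝ≥0∞ := if K < 0 then ENNReal.ofReal (π / √(-K)) else ⊤

/-! ### Distance realizers, triangles and curvature bounds -/

section Curvature

variable {X : Type*} [MetricSpace X]

/-- The `τ`-length of a curve `[0,1] → X`: the infimum of `∑ τ(γ(tᵢ), γ(tᵢ₊₁))` over all partitions
`0 = t₀ < … < tₙ = 1`. -/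
def tauLength (L : LorentzianData X) (γ : ℝ → X) : ℝ≥0∞ :=
  ⨅ (n : ℕ) (t : Fin (n + 1) → ℝ) (_ : StrictMono t) (_ : t 0 = 0) (_ : t (Fin.last n) = 1),
    ∑ i : Fin n, L.tau (γ (t i.castSucc)) (γ (t i.succ))

/-- `γ : [0,1] → X` is a distance realizer from `x` to `y`: a (Lipschitz) causal curve whose length
is the time separation of its endpoints. -/
structure IsRealizer (L : LorentzianData X) (γ : ℝ → X) (x y : X) : Prop where
  source : γ 0 = x
  target : γ 1 = y
  lipschitz : ∃ C, LipschitzOnWith C γ (Icc 0 1)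
  causal : ∀ s ∈ Icc (0 : ℝ) 1, ∀ t ∈ Icc (0 : ℝ) 1, s < t → L.le (γ s) (γ t)
  length_eq : tauLength L γ = L.tau x y

/-- A timelike triangle `a ≪ b ≪ c` whose sides are the distance realizers `α` from `a` to `b`,
`β` from `b` to `c` and `γ` from `a` to `c`, all contained in `U`. -/
structure IsTimelikeTriangle (L : LorentzianData X) (U : Set X) (a b c : X) (α β γ : ℝ → X) :
    Prop where
  ll_ab : L.ll a b
  ll_bc : L.ll b c
  realizer_ab : IsRealizer L α a b
  realizer_bc : IsRealizer L β b c
  realizer_ac : IsRealizer L γ a c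
  subset_ab : MapsTo α (Icc 0 1) U
  subset_bc : MapsTo β (Icc 0 1) U
  subset_ac : MapsTo γ (Icc 0 1) U

/-- `A B C` is a comparison triangle for `a b c` in the model space of curvature `K`. -/
structure IsComparisonTriangle (L : LorentzianData X) (K : ℝ) (a b c : X) (A B C : Plane) :
    Prop where
  tau_ab : (modelSpace K).tau A B = L.tau a b
  tau_bc : (modelSpace K).tau B C = L.tau b c
  tau_ac : (modelSpace K).tau A C = L.tau a c

/-- `Q` is the comparison point on the side from `A` to `B` in the model space of curvature `K` for
the point `q` on a side from `a` to `b`. -/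
structure IsComparisonPoint (L : LorentzianData X) (K : ℝ) (a b q : X) (A B Q : Plane) :
    Prop where
  le_left : (modelSpace K).le A Q
  le_right : (modelSpace K).le Q B
  tau_left : (modelSpace K).tau A Q = L.tau a q
  tau_right : (modelSpace K).tau Q B = L.tau q b

/-- Triangle comparison in `U` with the model space of curvature `K`: for each timelike triangle
`a ≪ b ≪ c` in `U` and each point `M` on the side `bc`, the relation `R (τ a M) (τ A N)` holds for
the comparison triangle `A B C` and the comparison point `N` of `M`. -/
def TriangleComparison (L : LorentzianData X) (K : ℝ) (R : ℝ≥0∞ → ℝ≥0∞ → Prop) (U : Set X) : Prop :=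
  ∀ (a b c : X) (α β γ : ℝ → X) (A B C : Plane),
    IsTimelikeTriangle L U a b c α β γ → L.tau a c < modelDiam K →
    IsComparisonTriangle L K a b c A B C →
    ∀ M ∈ β '' Icc 0 1, ∀ N : Plane, IsComparisonPoint L K b c M B C N →
      R (L.tau a M) ((modelSpace K).tau A N)

/-- Timelike sectional curvature is bounded below by `K` at `x`. -/
def CurvBoundedBelowAt (L : LorentzianData X) (K : ℝ) (x : X) : Prop :=
  ∃ U ∈ 𝓝 x, TriangleComparison L K (fun s t => s ≤ t) U

/-- Timelike sectional curvature is bounded above by `K` at `x`. -/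
def CurvBoundedAboveAt (L : LorentzianData X) (K : ℝ) (x : X) : Prop :=
  ∃ U ∈ 𝓝 x, TriangleComparison L K (fun s t => t ≤ s) U

/-- The space is (timelike) flat: timelike sectional curvature is bounded below and above by `0`. -/
def IsTimelikeFlat (L : LorentzianData X) : Prop :=
  ∀ x : X, CurvBoundedBelowAt L 0 x ∧ CurvBoundedAboveAt L 0 x

/-- `q` lies on one of the sides of the triangle `a b c` and `Q` is the comparison point of `q` on the
corresponding side of the comparison triangle `A B C`. -/
def IsSidePointPair (L : LorentzianData X) (K : ℝ) (a b c : X) (α β γ : ℝ → X) (A B C : Plane)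
    (q : X) (Q : Plane) : Prop :=
  (q ∈ α '' Icc 0 1 ∧ IsComparisonPoint L K a b q A B Q) ∨
  (q ∈ β '' Icc 0 1 ∧ IsComparisonPoint L K b c q B C Q) ∨
  (q ∈ γ '' Icc 0 1 ∧ IsComparisonPoint L K a c q A C Q)

/-- The strongest form of comparison with the flat model: around each point there is an open set `U`
such that `τ` is finite and continuous on `U × U`, timelike related points of `U` are joined by a
distance realizer in `U`, and for each timelike triangle in `U` the time separation of any two points
on its sides equals that of their comparison points in the Minkowski plane. -/
def IsStronglyTimelikeFlat (L : LorentzianData X) : Prop :=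
  ∀ x : X, ∃ U : Set X, IsOpen U ∧ x ∈ U ∧
    (∀ y ∈ U, ∀ z ∈ U, L.tau y z ≠ ⊤) ∧
    ContinuousOn (fun q : X × X => L.tau q.1 q.2) (U ×ˢ U) ∧
    (∀ y ∈ U, ∀ z ∈ U, L.ll y z → ∃ γ : ℝ → X, IsRealizer L γ y z ∧ MapsTo γ (Icc 0 1) U) ∧
    ∀ (a b c : X) (α β γ : ℝ → X) (A B C : Plane),
      IsTimelikeTriangle L U a b c α β γ → IsComparisonTriangle L 0 a b c A B C →
      ∀ (q r : X) (Q R : Plane), IsSidePointPair L 0 a b c α β γ A B C q Q →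
        IsSidePointPair L 0 a b c α β γ A B C r R → L.tau q r = (modelSpace 0).tau Q R

end Curvature

end

/-!
For `p ≠ 2` the argument is infinitesimal. A triangle `a b c` in the plane with `b - a = v`,
`c - b = 2 • w` and straight sides has the median `v + w` from `a` to the midpoint of `bc`, and in the
Minkowski plane the length of the median is given by the parallelogram identity. In a model space of
curvature `K` the median of a triangle scaled by `ε` has length given by
`cosh m = cosh x * cosh y / cosh h` (or the same with `cos`), where `x ± y` and `2 * h` are the sides,
so that the flat formula holds up to terms of higher order in `ε`
(`eventually_exists_isModelMedian`). As `τ^p` is homogeneous and translation invariant, it suffices that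
its parallelogram identity fails: a defect of either sign then contradicts one of the two curvature
bounds, for all `K` and in every neighbourhood (`exists_triangle_of_parallelogram_defect`). The identity
fails for `v = (1, -1/2)`, `w = (1, 1/2)` because `y ↦ y ^ (2 / p)` is strictly convex or strictly concave
(`rpow_parallelogram_ne`), and passing from the parallelogram to that of its diagonals, with `2 • w` and
`v` in the roles of `v` and `w`, reverses the sign of the defect.

For `p = 2` the plane is the Minkowski plane. The equality case of the reverse triangle inequality
(`eq_add_smul_of_modelTau_le`) shows that realizers are straight and that comparison points divide the
sides in the same ratio. Time separations on the sides are then determined by the Gram matrix of two side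
vectors, including the time orientation, which is the sign of the product with a future timelike vector
(`modelTau_zero_eq_ite`).

For `p = ∞` time separations of timelike related points are differences of time coordinates. So
`τ(a, c) = τ(a, b) + τ(b, c)` for all timelike triangles, comparison triangles are contained in a segment,
and both compared quantities are the difference of time coordinates.
-/

/-! ### Distance realizers -/

/-- Every point of a distance realizer satisfies the inequality opposite to the reverse triangle
inequality. -/
theorem IsRealizer.tau_le_add {X : Type*} [MetricSpace X] {L : LorentzianData X} {γ : ℝ → X}
    {x y : X} (h : IsRealizer L γ x y) {t : ℝ} (ht : t ∈ Icc (0 : ℝ) 1) :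
    L.tau x y ≤ L.tau x (γ t) + L.tau (γ t) y := by
  rcases ht.1.eq_or_lt with rfl | h0
  · rw [h.source]
    exact le_add_self
  rcases ht.2.eq_or_lt with rfl | h1
  · rw [h.target]
    exact le_self_add
  rw [← h.length_eq, tauLength]
  have hm : StrictMono (![0, t, 1] : Fin 3 → ℝ) := by
    rw [Fin.strictMono_iff_lt_succ]
    intro i
    fin_cases i
    · simpa using h0
    · simpa using h1
  refine iInf_le_of_le 2 (iInf_le_of_le ![0, t, 1] (iInf_le_of_le hm
    (iInf_le_of_le rfl (iInf_le_of_le rfl ?_))))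
  simp [Fin.sum_univ_two, h.source, h.target]

theorem IsRealizer.le_apply {X : Type*} [MetricSpace X] {L : LorentzianData X} {γ : ℝ → X}
    {x y : X} (h : IsRealizer L γ x y) (hrefl : ∀ z, L.le z z) {t : ℝ} (ht : t ∈ Icc (0 : ℝ) 1) :
    L.le x (γ t) ∧ L.le (γ t) y := by
  constructor
  · rcases ht.1.eq_or_lt with rfl | h0
    · rw [h.source]
      exact hrefl x
    · simpa [h.source] using h.causal 0 (by simp) t ht h0
  · rcases ht.2.eq_or_lt with rfl | h1
    · rw [h.target]
      exact hrefl y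
    · simpa [h.target] using h.causal t ht 1 (by simp) h1

theorem minkowskiLE_refl (x : Plane) : MinkowskiLE x x := by simp [MinkowskiLE]

theorem lorentzNorm_nonneg (p : ℝ) (v : Plane) : 0 ≤ lorentzNorm p v := by
  unfold lorentzNorm
  split_ifs with h
  · exact rpow_nonneg (sub_nonneg.2 h.1) _
  · exact le_rfl

theorem lorentzNorm_smul {p r : ℝ} (hp : 0 < p) (hr : 0 ≤ r) (v : Plane) :
    lorentzNorm p (r • v) = r * lorentzNorm p v := by
  rcases hr.eq_or_lt with rfl | hr
  · simp [lorentzNorm]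
  have hrp : 0 < r ^ p := rpow_pos_of_pos hr p
  have key : |v 1| ^ p ≤ |v 0| ^ p ∧ 0 < v 0 ↔
      |(r • v) 1| ^ p ≤ |(r • v) 0| ^ p ∧ 0 < (r • v) 0 := by
    simp only [PiLp.smul_apply, smul_eq_mul, abs_mul, abs_of_pos hr,
      mul_rpow hr.le (abs_nonneg _), mul_le_mul_iff_right₀ hrp, mul_pos_iff_of_pos_left hr]
  unfold lorentzNorm
  rw [← if_congr key rfl rfl]
  split_ifs with h
  · simp only [PiLp.smul_apply, smul_eq_mul, abs_mul, abs_of_pos hr,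
      mul_rpow hr.le (abs_nonneg _)]
    rw [← mul_sub, mul_rpow hrp.le (sub_nonneg.2 h.1), ← rpow_mul hr.le,
      mul_one_div_cancel hp.ne', rpow_one]
  · simp

theorem sum_succ_sub_castSucc {n : ℕ} (t : Fin (n + 1) → ℝ) :
    ∑ i : Fin n, (t i.succ - t i.castSucc) = t (Fin.last n) - t 0 := by
  induction n with
  | zero => simp
  | succ n ih =>
    rw [Fin.sum_univ_castSucc]
    have := ih (fun i => t i.castSucc)
    simp only [Fin.castSucc_zero] at this
    simp only [Fin.succ_castSucc, this, Fin.succ_last]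
    ring

/-- Straight timelike segments are distance realizers, since `τ^p` is additive along them. -/
theorem isRealizer_lineMap {p : ℝ} (hp : 0 < p) {x y : Plane} (h : MinkowskiLE x y) :
    IsRealizer (lpPlane p) (AffineMap.lineMap x y) x y where
  source := by simp
  target := by simp
  lipschitz := ⟨_, (lipschitzWith_lineMap x y).lipschitzOnWith⟩
  causal := by
    intro s _ t _ hst
    have h' : |y 1 - x 1| ≤ y 0 - x 0 := h
    have e (i : Fin 2) : (AffineMap.lineMap x y t : Plane) i - (AffineMap.lineMap x y s : Plane) i
        = (t - s) * (y i - x i) := by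
      simp [AffineMap.lineMap_apply]
      ring
    change |_| ≤ _
    rw [e, e, abs_mul, abs_of_pos (sub_pos.2 hst)]
    exact mul_le_mul_of_nonneg_left h' (sub_pos.2 hst).le
  length_eq := by
    have e {s t : ℝ} (hst : s ≤ t) :
        (lpPlane p).tau (AffineMap.lineMap x y s) (AffineMap.lineMap x y t) =
          ENNReal.ofReal ((t - s) * lorentzNorm p (y - x)) := by
      have : (AffineMap.lineMap x y t : Plane) - AffineMap.lineMap x y s = (t - s) • (y - x) := by
        simp only [AffineMap.lineMap_apply, vsub_eq_sub, vadd_eq_add]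
        module
      simp only [lpPlane, this, lorentzNorm_smul hp (sub_nonneg.2 hst)]
    have key (n : ℕ) (t : Fin (n + 1) → ℝ) (hm : StrictMono t) (h0 : t 0 = 0)
        (h1 : t (Fin.last n) = 1) :
        ∑ i : Fin n, (lpPlane p).tau (AffineMap.lineMap x y (t i.castSucc))
          (AffineMap.lineMap x y (t i.succ)) = (lpPlane p).tau x y := by
      have hle (i : Fin n) : t i.castSucc ≤ t i.succ := hm.monotone (Fin.castSucc_lt_succ).le
      simp only [e (hle _)]
      rw [← ENNReal.ofReal_sum_of_nonneg fun i _ =>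
        mul_nonneg (sub_nonneg.2 (hle i)) (lorentzNorm_nonneg _ _), ← Finset.sum_mul,
        sum_succ_sub_castSucc, h0, h1]
      simp [lpPlane]
    rw [tauLength]
    refine le_antisymm ?_ ?_
    · have hm : StrictMono (![0, 1] : Fin 2 → ℝ) := by
        rw [Fin.strictMono_iff_lt_succ]
        intro i
        fin_cases i
        simp
      exact iInf_le_of_le 1 (iInf_le_of_le ![0, 1] (iInf_le_of_le hm
        (iInf_le_of_le rfl (iInf_le_of_le rfl (key 1 _ hm rfl rfl).le))))
    · refine le_iInf fun n => le_iInf fun t => le_iInf fun hm => le_iInf fun h0 =>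
        le_iInf fun h1 => (key n t hm h0 h1).ge

/-! ### The Minkowski plane -/

/-- The time separation of the Minkowski plane in coordinates. -/
theorem modelTau_zero (x y : Plane) : modelTau 0 x y =
    ENNReal.ofReal √(max 0 ((y 0 - x 0) - (y 1 - x 1)) * max 0 ((y 0 - x 0) + (y 1 - x 1))) := by
  unfold modelTau ModelLL confSpace confTime
  simp only [lt_irrefl, if_false, abs_lt]
  split_ifs with h
  · rw [max_eq_right (by linarith), max_eq_right (by linarith)]
    ring_nf
  · rw [not_and_or, not_lt, not_lt] at h
    rcases h with h | h
    · rw [max_eq_left (a := (0 : ℝ)) (b := _ + _) (by linarith)]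
      simp
    · rw [max_eq_left (by linarith)]
      simp

theorem lpPlane_two_tau : (lpPlane 2).tau = modelTau 0 := by
  ext1 x; ext1 y
  rw [modelTau_zero]
  simp only [lpPlane]
  congr 1
  unfold lorentzNorm
  simp only [rpow_two, sq_abs, PiLp.sub_apply]
  generalize y 0 - x 0 = s
  generalize y 1 - x 1 = t
  split_ifs with h
  · have h' := (abs_le.1 (abs_le_of_sq_le_sq h.1 h.2.le))
    rw [max_eq_right (by linarith), max_eq_right (by linarith), sqrt_eq_rpow]
    ring_nf
  · symm
    rw [sqrt_eq_zero (by positivity)]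
    by_contra hc
    obtain ⟨h1, h2⟩ := mul_ne_zero_iff.1 hc
    have h1' : 0 < s - t := by
      by_contra hn
      exact h1 (max_eq_left (not_lt.1 hn))
    have h2' : 0 < s + t := by
      by_contra hn
      exact h2 (max_eq_left (not_lt.1 hn))
    exact h ⟨by nlinarith, by linarith⟩

/-- The Minkowski scalar product, of signature `(+, -)`. -/
def minkowskiProd (v w : Plane) : ℝ := v 0 * w 0 - v 1 * w 1

theorem modelTau_zero_of_le {x y : Plane} (h : MinkowskiLE x y) :
    modelTau 0 x y = ENNReal.ofReal √(minkowskiProd (y - x) (y - x)) := by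
  have h' := abs_le.1 (show |y 1 - x 1| ≤ y 0 - x 0 from h)
  rw [modelTau_zero, max_eq_right (by linarith), max_eq_right (by linarith)]
  simp only [minkowskiProd, PiLp.sub_apply]
  ring_nf

theorem modelTau_zero_ne_top (x y : Plane) : modelTau 0 x y ≠ ⊤ := by
  rw [modelTau_zero]
  exact ENNReal.ofReal_ne_top

theorem modelTau_zero_pos_iff {x y : Plane} : 0 < modelTau 0 x y ↔ MinkowskiLL x y := by
  rw [modelTau_zero, ENNReal.ofReal_pos, sqrt_pos, MinkowskiLL, abs_lt]
  constructor
  · intro h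
    constructor
    · by_contra hn
      rw [max_eq_left (a := (0 : ℝ)) (b := _ + _) (by linarith)] at h
      simp at h
    · by_contra hn
      rw [max_eq_left (by linarith)] at h
      simp at h
  · rintro ⟨h1, h2⟩
    rw [max_eq_right (by linarith), max_eq_right (by linarith)]
    apply mul_pos <;> linarith

theorem continuous_modelTau_zero : Continuous fun q : Plane × Plane => modelTau 0 q.1 q.2 := by
  simp only [modelTau_zero]
  refine ENNReal.continuous_ofReal.comp ?_
  fun_prop

theorem modelTau_zero_add_smul {r : ℝ} (hr : 0 ≤ r) (x v : Plane) :
    modelTau 0 x (x + r • v) = ENNReal.ofReal r * modelTau 0 x (x + v) := by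
  rw [← lpPlane_two_tau]
  simp only [lpPlane, add_sub_cancel_left]
  rw [lorentzNorm_smul two_pos hr, ENNReal.ofReal_mul hr]

/-- The time separation in terms of scalar products only: the time orientation is read off from the
scalar product with some fixed future timelike vector `v`. -/
theorem modelTau_zero_eq_ite {x y v : Plane} (hv : |v 1| < v 0) : modelTau 0 x y =
    if 0 < minkowskiProd (y - x) (y - x) ∧ 0 < minkowskiProd v (y - x) then
      ENNReal.ofReal √(minkowskiProd (y - x) (y - x)) else 0 := by
  by_cases h : MinkowskiLL x y
  · have h' : |y 1 - x 1| < y 0 - x 0 := h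
    rw [modelTau_zero_of_le h'.le, if_pos]
    rw [abs_lt] at h' hv
    simp only [minkowskiProd, PiLp.sub_apply]
    constructor
    · nlinarith [mul_pos (sub_pos.2 h'.1) (sub_pos.2 h'.2)]
    · nlinarith [mul_pos (sub_pos.2 h'.1) (sub_pos.2 hv.2),
        mul_pos (sub_pos.2 h'.2) (sub_pos.2 hv.1)]
  · rw [← modelTau_zero_pos_iff, pos_iff_ne_zero, not_not] at h
    rw [h, if_neg]
    rintro ⟨h1, h2⟩
    refine h.not_gt (modelTau_zero_pos_iff.2 (show |y 1 - x 1| < y 0 - x 0 from ?_))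
    simp only [minkowskiProd, PiLp.sub_apply] at h1 h2
    generalize y 0 - x 0 = s at *
    generalize y 1 - x 1 = t at *
    rw [abs_lt] at hv
    have h3 : |t| < |s| := sq_lt_sq.1 (by nlinarith)
    rcases le_or_gt s 0 with hs | hs
    · exfalso
      rw [abs_of_nonpos hs, abs_lt] at h3
      nlinarith [mul_nonneg (sub_nonneg.2 h3.1.le) (sub_nonneg.2 hv.1.le),
        mul_nonneg (sub_nonneg.2 h3.2.le) (sub_nonneg.2 hv.2.le)]
    · rwa [abs_of_pos hs] at h3

/-- The equality case of the reverse triangle inequality: in the Minkowski plane a point between `x`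
and `y` at which it is not strict lies on the segment, where its distance to `x` determines it. -/
theorem eq_add_smul_of_modelTau_le {x y q : Plane} (hxq : MinkowskiLE x q) (hqy : MinkowskiLE q y)
    (hxy : MinkowskiLL x y) (h : modelTau 0 x y ≤ modelTau 0 x q + modelTau 0 q y) :
    q = x + ((modelTau 0 x q).toReal / (modelTau 0 x y).toReal) • (y - x) := by
  have hxy' : |y 1 - x 1| < y 0 - x 0 := hxy
  have hxq' : |q 1 - x 1| ≤ q 0 - x 0 := hxq
  have hqy' : |y 1 - q 1| ≤ y 0 - q 0 := hqy
  rw [modelTau_zero_of_le hxy'.le, modelTau_zero_of_le hxq, modelTau_zero_of_le hqy] at *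
  rw [← ENNReal.ofReal_add (sqrt_nonneg _) (sqrt_nonneg _),
    ENNReal.ofReal_le_ofReal_iff (by positivity)] at h
  rw [ENNReal.toReal_ofReal (sqrt_nonneg _), ENNReal.toReal_ofReal (sqrt_nonneg _)]
  simp only [minkowskiProd, PiLp.sub_apply] at h ⊢
  rw [abs_lt] at hxy'
  rw [abs_le] at hxq' hqy'
  set a := q 0 - x 0 with ha
  set b := q 1 - x 1 with hb
  set s := y 0 - x 0 with hs
  set t := y 1 - x 1 with ht
  rw [show y 0 - q 0 = s - a by ring, show y 1 - q 1 = t - b by ring] at *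
  have h1 : 0 ≤ a * a - b * b := by nlinarith
  have h2 : 0 < s * s - t * t := by nlinarith
  have h3 : 0 ≤ (s - a) * (s - a) - (t - b) * (t - b) := by nlinarith
  have h4 : 0 ≤ (s - a) * a - (t - b) * b := by nlinarith
  have e1 := mul_self_sqrt h1
  have e2 := mul_self_sqrt h2.le
  have e3 := mul_self_sqrt h3
  have p1 := sqrt_nonneg (a * a - b * b)
  have p2 := sqrt_pos.2 h2
  have p3 := sqrt_nonneg ((s - a) * (s - a) - (t - b) * (t - b))
  set N1 := √(a * a - b * b)
  set N2 := √(s * s - t * t)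
  set N3 := √((s - a) * (s - a) - (t - b) * (t - b))
  have h12 : N1 ≤ N2 := by nlinarith
  have h5 : s * a - t * b ≤ N2 * N1 := by nlinarith
  have h6 : 0 ≤ s * a - t * b := by nlinarith
  -- The reverse Cauchy-Schwarz inequality is an equality, which forces proportionality.
  have h7 : (s * b - t * a) ^ 2 ≤ 0 := by
    have : (s * a - t * b) * (s * a - t * b) ≤ (N2 * N1) * (N2 * N1) :=
      mul_self_le_mul_self h6 h5
    have e4 : (N2 * N1) * (N2 * N1) = (s * s - t * t) * (a * a - b * b) := by
      rw [← e1, ← e2]; ring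
    rw [e4] at this
    linarith only [this]
  have h8 : s * b = t * a := sub_eq_zero.1 (pow_eq_zero_iff two_ne_zero |>.1
    (le_antisymm h7 (sq_nonneg _)))
  have hs0 : 0 < s := by linarith
  have ha0 : 0 ≤ a := by linarith
  have h9 : N1 * s = a * N2 := by
    have : (N1 * s) ^ 2 = (a * N2) ^ 2 := by
      calc (N1 * s) ^ 2 = (N1 * N1) * s ^ 2 := by ring
        _ = a ^ 2 * s ^ 2 - (s * b) ^ 2 := by rw [e1]; ring
        _ = a ^ 2 * (N2 * N2) := by rw [h8, e2]; ring
        _ = _ := by ring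
    exact (pow_left_inj₀ (by positivity) (by positivity) two_ne_zero).1 this
  have h10 : N1 * t = b * N2 := by
    have : s * (N1 * t) = s * (b * N2) := by linear_combination t * h9 - N2 * h8
    exact mul_left_cancel₀ hs0.ne' this
  ext i
  fin_cases i
  · simp only [PiLp.add_apply, PiLp.smul_apply, PiLp.sub_apply, smul_eq_mul, Fin.zero_eta, ← hs]
    field_simp
    linear_combination N2 * ha - h9
  · simp only [PiLp.add_apply, PiLp.smul_apply, PiLp.sub_apply, smul_eq_mul, Fin.mk_one, ← ht]
    field_simp
    linear_combination N2 * hb - h10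

/-! ### The planes with `p = 2` and `p = ∞` -/

theorem modelLE_zero (x y : Plane) : ModelLE 0 x y ↔ MinkowskiLE x y := by
  simp [ModelLE, MinkowskiLE, confSpace, confTime]

theorem MinkowskiLL.le {x y : Plane} (h : MinkowskiLL x y) : MinkowskiLE x y :=
  le_of_lt (show |y 1 - x 1| < y 0 - x 0 from h)

theorem MinkowskiLL.trans_le {x y z : Plane} (h : MinkowskiLL x y) (h' : MinkowskiLE y z) :
    MinkowskiLL x z := by
  have h1 : |y 1 - x 1| < y 0 - x 0 := h
  have h2 : |z 1 - y 1| ≤ z 0 - y 0 := h'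
  change |z 1 - x 1| < z 0 - x 0
  rw [abs_lt] at h1 ⊢
  rw [abs_le] at h2
  constructor <;> linarith

/-- For `p = 2` a point on a side and its comparison point divide their sides in the same ratio. -/
theorem exists_eq_add_smul_of_isComparisonPoint {x y q X Y Q : Plane} {γ : ℝ → Plane}
    (hγ : IsRealizer (lpPlane 2) γ x y) (hxy : MinkowskiLL x y)
    (hXY : modelTau 0 X Y = modelTau 0 x y) (hq : q ∈ γ '' Icc 0 1)
    (hQ : IsComparisonPoint (lpPlane 2) 0 x y q X Y Q) :
    ∃ r : ℝ, q = x + r • (y - x) ∧ Q = X + r • (Y - X) := by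
  obtain ⟨t, ht, rfl⟩ := hq
  have hle := hγ.le_apply minkowskiLE_refl ht
  have hadd := hγ.tau_le_add ht
  have h1 := hQ.tau_left
  have h2 := hQ.tau_right
  rw [lpPlane_two_tau] at h1 h2 hadd
  simp only [modelSpace] at h1 h2
  refine ⟨_, eq_add_smul_of_modelTau_le hle.1 hle.2 hxy hadd, ?_⟩
  rw [← h1, ← hXY]
  refine eq_add_smul_of_modelTau_le ((modelLE_zero _ _).1 hQ.le_left)
    ((modelLE_zero _ _).1 hQ.le_right) ?_ ?_
  · rw [← modelTau_zero_pos_iff, hXY]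
    exact modelTau_zero_pos_iff.2 hxy
  · rwa [h1, h2, hXY]

theorem exists_eq_of_isSidePointPair {U : Set Plane} {a b c A B C q Q : Plane}
    {α β γ : ℝ → Plane} (hT : IsTimelikeTriangle (lpPlane 2) U a b c α β γ)
    (hC : IsComparisonTriangle (lpPlane 2) 0 a b c A B C)
    (h : IsSidePointPair (lpPlane 2) 0 a b c α β γ A B C q Q) :
    ∃ r s : ℝ, q = a + (r • (b - a) + s • (c - b)) ∧ Q = A + (r • (B - A) + s • (C - B)) := by
  have hab : MinkowskiLL a b := hT.ll_ab
  have hbc : MinkowskiLL b c := hT.ll_bc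
  have h1 := hC.tau_ab
  have h2 := hC.tau_bc
  have h3 := hC.tau_ac
  rw [lpPlane_two_tau] at h1 h2 h3
  rcases h with ⟨hq, hQ⟩ | ⟨hq, hQ⟩ | ⟨hq, hQ⟩
  · obtain ⟨r, rfl, rfl⟩ := exists_eq_add_smul_of_isComparisonPoint hT.realizer_ab hab h1 hq hQ
    exact ⟨r, 0, by module, by module⟩
  · obtain ⟨r, rfl, rfl⟩ := exists_eq_add_smul_of_isComparisonPoint hT.realizer_bc hbc h2 hq hQ
    exact ⟨1, r, by module, by module⟩
  · obtain ⟨r, rfl, rfl⟩ :=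
      exists_eq_add_smul_of_isComparisonPoint hT.realizer_ac (hab.trans_le hbc.le) h3 hq hQ
    exact ⟨r, r, by module, by module⟩

theorem minkowskiProd_self_eq {x y X Y : Plane} (h : MinkowskiLE x y) (H : MinkowskiLE X Y)
    (e : modelTau 0 X Y = modelTau 0 x y) :
    minkowskiProd (Y - X) (Y - X) = minkowskiProd (y - x) (y - x) := by
  have key {u v : Plane} (huv : MinkowskiLE u v) : 0 ≤ minkowskiProd (v - u) (v - u) := by
    have h' := abs_le.1 (show |v 1 - u 1| ≤ v 0 - u 0 from huv)
    simp only [minkowskiProd, PiLp.sub_apply]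
    nlinarith
  rw [modelTau_zero_of_le h, modelTau_zero_of_le H,
    ENNReal.ofReal_eq_ofReal_iff (sqrt_nonneg _) (sqrt_nonneg _)] at e
  exact (sqrt_inj (key H) (key h)).1 e

/-- Time separations of points on the sides are determined by the Gram matrix of `b - a`, `c - b`,
hence by the side lengths. -/
theorem tau_eq_of_isSidePointPair {U : Set Plane} {a b c A B C q Q r R : Plane}
    {α β γ : ℝ → Plane} (hT : IsTimelikeTriangle (lpPlane 2) U a b c α β γ)
    (hC : IsComparisonTriangle (lpPlane 2) 0 a b c A B C)
    (hq : IsSidePointPair (lpPlane 2) 0 a b c α β γ A B C q Q)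
    (hr : IsSidePointPair (lpPlane 2) 0 a b c α β γ A B C r R) :
    (lpPlane 2).tau q r = (modelSpace 0).tau Q R := by
  obtain ⟨x, y, rfl, rfl⟩ := exists_eq_of_isSidePointPair hT hC hq
  obtain ⟨z, w, rfl, rfl⟩ := exists_eq_of_isSidePointPair hT hC hr
  have hab : MinkowskiLL a b := hT.ll_ab
  have hbc : MinkowskiLL b c := hT.ll_bc
  have h1 := hC.tau_ab
  have h2 := hC.tau_bc
  have h3 := hC.tau_ac
  rw [lpPlane_two_tau] at h1 h2 h3
  change modelTau 0 _ _ = _ at h1 h2 h3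
  have hAB : MinkowskiLL A B := modelTau_zero_pos_iff.1 (h1 ▸ modelTau_zero_pos_iff.2 hab)
  have hBC : MinkowskiLL B C := modelTau_zero_pos_iff.1 (h2 ▸ modelTau_zero_pos_iff.2 hbc)
  have e1 := minkowskiProd_self_eq hab.le hAB.le h1
  have e2 := minkowskiProd_self_eq hbc.le hBC.le h2
  have e3 := minkowskiProd_self_eq (hab.trans_le hbc.le).le (hAB.trans_le hBC.le).le h3
  rw [lpPlane_two_tau]
  change _ = modelTau 0 _ _
  rw [modelTau_zero_eq_ite (v := b - a) (by simpa [MinkowskiLL] using hab),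
    modelTau_zero_eq_ite (v := B - A) (by simpa [MinkowskiLL] using hAB)]
  have add_sub (p v w : Plane) : p + v - (p + w) = v - w := by module
  rw [add_sub, add_sub]
  have e4 : minkowskiProd (B - A) (C - B) = minkowskiProd (b - a) (c - b) := by
    simp only [minkowskiProd, PiLp.sub_apply] at e1 e2 e3 ⊢
    linear_combination (e3 - e1 - e2) / 2
  set u := z • (b - a) + w • (c - b) - (x • (b - a) + y • (c - b)) with hu
  set V := z • (B - A) + w • (C - B) - (x • (B - A) + y • (C - B)) with hV
  have e5 : minkowskiProd u u = minkowskiProd V V := by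
    rw [hu, hV]
    simp only [minkowskiProd, PiLp.sub_apply, PiLp.add_apply, PiLp.smul_apply, smul_eq_mul] at *
    linear_combination -(z - x) ^ 2 * e1 - (w - y) ^ 2 * e2 - 2 * (z - x) * (w - y) * e4
  have e6 : minkowskiProd (b - a) u = minkowskiProd (B - A) V := by
    rw [hu, hV]
    simp only [minkowskiProd, PiLp.sub_apply, PiLp.add_apply, PiLp.smul_apply, smul_eq_mul] at *
    linear_combination -(z - x) * e1 - (w - y) * e4
  rw [e5, e6]

theorem isStronglyTimelikeFlat_lpPlane_two : IsStronglyTimelikeFlat (lpPlane 2) := by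
  refine fun x => ⟨univ, isOpen_univ, mem_univ x, ?_, ?_, ?_, ?_⟩
  · intro y _ z _
    rw [lpPlane_two_tau]
    exact modelTau_zero_ne_top y z
  · rw [lpPlane_two_tau]
    exact continuous_modelTau_zero.continuousOn
  · exact fun y _ z _ h => ⟨_, isRealizer_lineMap two_pos (MinkowskiLL.le h), mapsTo_univ _ _⟩
  · exact fun a b c α β γ A B C hT hC q r Q R hq hr => tau_eq_of_isSidePointPair hT hC hq hr

/-- A space is flat if all distances from the first vertex of a timelike triangle to the opposite side
agree with those in the Minkowski plane. -/
theorem isTimelikeFlat_of_tau_eq {X : Type*} [MetricSpace X] {L : LorentzianData X}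
    (h : ∀ (a b c : X) (α β γ : ℝ → X) (A B C : Plane), IsTimelikeTriangle L univ a b c α β γ →
      IsComparisonTriangle L 0 a b c A B C → ∀ M ∈ β '' Icc 0 1, ∀ N : Plane,
      IsComparisonPoint L 0 b c M B C N → L.tau a M = (modelSpace 0).tau A N) :
    IsTimelikeFlat L :=
  fun _ => ⟨⟨univ, univ_mem, fun a b c α β γ A B C hT _ hC M hM N hN =>
      (h a b c α β γ A B C hT hC M hM N hN).le⟩,
    ⟨univ, univ_mem, fun a b c α β γ A B C hT _ hC M hM N hN =>
      (h a b c α β γ A B C hT hC M hM N hN).ge⟩⟩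

theorem isTimelikeFlat_lpPlane_two : IsTimelikeFlat (lpPlane 2) := by
  refine isTimelikeFlat_of_tau_eq fun a b c α β γ A B C hT hC M hM N hN => ?_
  refine tau_eq_of_isSidePointPair hT hC (Or.inl ⟨⟨0, by simp, hT.realizer_ab.source⟩, ?_⟩)
    (Or.inr (Or.inl ⟨hM, hN⟩))
  have hself (x : Plane) : modelTau 0 x x = 0 := by simp [modelTau_zero]
  have hAB : MinkowskiLL A B := by
    have h1 := hC.tau_ab
    rw [lpPlane_two_tau] at h1
    change modelTau 0 A B = _ at h1
    exact modelTau_zero_pos_iff.1 (h1 ▸ modelTau_zero_pos_iff.2 hT.ll_ab)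
  refine ⟨(modelLE_zero _ _).2 (minkowskiLE_refl A), (modelLE_zero _ _).2 hAB.le, ?_, hC.tau_ab⟩
  rw [lpPlane_two_tau]
  simp [modelSpace, hself]

theorem lpPlaneInf_tau_of_ll {x y : Plane} (h : MinkowskiLL x y) :
    lpPlaneInf.tau x y = ENNReal.ofReal (y 0 - x 0) := by
  have h' : |y 1 - x 1| < y 0 - x 0 := h
  simp [lpPlaneInf, lorentzNormInf, h']

theorem lpPlaneInf_tau_le {x y : Plane} : lpPlaneInf.tau x y ≤ ENNReal.ofReal (y 0 - x 0) := by
  simp only [lpPlaneInf, lorentzNormInf]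
  split_ifs
  · simp
  · simp

/-- On a realizer of `τ^∞` the time separations are the differences of the time coordinates. -/
theorem tau_eq_of_isRealizer_lpPlaneInf {x y : Plane} {γ : ℝ → Plane}
    (hγ : IsRealizer lpPlaneInf γ x y) (hxy : MinkowskiLL x y) {t : ℝ} (ht : t ∈ Icc (0 : ℝ) 1) :
    lpPlaneInf.tau x (γ t) = ENNReal.ofReal (γ t 0 - x 0) ∧
      lpPlaneInf.tau (γ t) y = ENNReal.ofReal (y 0 - γ t 0) := by
  obtain ⟨h1, h2⟩ := hγ.le_apply minkowskiLE_refl ht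
  have h1' := (abs_nonneg _).trans (show |γ t 1 - x 1| ≤ γ t 0 - x 0 from h1)
  have h2' := (abs_nonneg _).trans (show |y 1 - γ t 1| ≤ y 0 - γ t 0 from h2)
  have h := hγ.tau_le_add ht
  have l1 := lpPlaneInf_tau_le (x := x) (y := γ t)
  have l2 := lpPlaneInf_tau_le (x := γ t) (y := y)
  rw [lpPlaneInf_tau_of_ll hxy, show y 0 - x 0 = (γ t 0 - x 0) + (y 0 - γ t 0) by ring,
    ENNReal.ofReal_add h1' h2'] at h
  constructor
  · refine l1.antisymm ?_
    by_contra hn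
    exact (ENNReal.add_lt_add_of_lt_of_le (ne_top_of_le_ne_top ENNReal.ofReal_ne_top l2)
      (not_le.1 hn) l2).not_ge h
  · refine l2.antisymm ?_
    by_contra hn
    exact (ENNReal.add_lt_add_of_le_of_lt (ne_top_of_le_ne_top ENNReal.ofReal_ne_top l1)
      l1 (not_le.1 hn)).not_ge h

/-- All timelike triangles of `τ^∞` are degenerate, so that comparison triangles are contained in a
segment of the Minkowski plane. -/
theorem isTimelikeFlat_lpPlaneInf : IsTimelikeFlat lpPlaneInf := by
  refine isTimelikeFlat_of_tau_eq fun a b c α β γ A B C hT hC M hM N hN => ?_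
  obtain ⟨t, ht, rfl⟩ := hM
  have hab : MinkowskiLL a b := hT.ll_ab
  have hbc : MinkowskiLL b c := hT.ll_bc
  have hbM : MinkowskiLE b (β t) := (hT.realizer_bc.le_apply minkowskiLE_refl ht).1
  obtain ⟨m1, m2⟩ := tau_eq_of_isRealizer_lpPlaneInf hT.realizer_bc hbc ht
  have hs : 0 < b 0 - a 0 := (abs_nonneg _).trans_lt (show |b 1 - a 1| < b 0 - a 0 from hab)
  have hu : 0 < c 0 - b 0 := (abs_nonneg _).trans_lt (show |c 1 - b 1| < c 0 - b 0 from hbc)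
  have hr : 0 ≤ β t 0 - b 0 :=
    (abs_nonneg _).trans (show |β t 1 - b 1| ≤ β t 0 - b 0 from hbM)
  have hr' : 0 ≤ c 0 - β t 0 :=
    (abs_nonneg _).trans (show |c 1 - β t 1| ≤ c 0 - β t 0 from
      (hT.realizer_bc.le_apply minkowskiLE_refl ht).2)
  have h1 : modelTau 0 A B = ENNReal.ofReal (b 0 - a 0) :=
    hC.tau_ab.trans (lpPlaneInf_tau_of_ll hab)
  have h2 : modelTau 0 B C = ENNReal.ofReal (c 0 - b 0) :=
    hC.tau_bc.trans (lpPlaneInf_tau_of_ll hbc)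
  have h3 : modelTau 0 A C = ENNReal.ofReal (c 0 - a 0) :=
    hC.tau_ac.trans (lpPlaneInf_tau_of_ll (hab.trans_le hbc.le))
  have h4 : modelTau 0 B N = ENNReal.ofReal (β t 0 - b 0) := hN.tau_left.trans m1
  have h5 : modelTau 0 N C = ENNReal.ofReal (c 0 - β t 0) := hN.tau_right.trans m2
  have hAB : MinkowskiLL A B := modelTau_zero_pos_iff.1 (by rw [h1]; simpa using hs)
  have hBC : MinkowskiLL B C := modelTau_zero_pos_iff.1 (by rw [h2]; simpa using hu)
  have hB := eq_add_smul_of_modelTau_le hAB.le hBC.le (hAB.trans_le hBC.le) (by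
    rw [h1, h2, h3, ← ENNReal.ofReal_add hs.le hu.le]
    exact le_of_eq (congrArg _ (by ring)))
  have hN' := eq_add_smul_of_modelTau_le ((modelLE_zero _ _).1 hN.le_left)
    ((modelLE_zero _ _).1 hN.le_right) hBC (by
    rw [h2, h4, h5, ← ENNReal.ofReal_add hr hr']
    exact le_of_eq (congrArg _ (by ring)))
  rw [h1, h3, ENNReal.toReal_ofReal hs.le, ENNReal.toReal_ofReal (by linarith)] at hB
  rw [h4, h2, ENNReal.toReal_ofReal hr, ENNReal.toReal_ofReal hu.le] at hN'
  have hN2 : N = A + ((β t 0 - a 0) / (c 0 - a 0)) • (C - A) := by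
    have hca : c 0 - a 0 ≠ 0 := by linarith
    have hCB : C - B = (1 - (b 0 - a 0) / (c 0 - a 0)) • (C - A) := by
      nth_rewrite 1 [hB]
      module
    rw [hN', hCB, smul_smul]
    nth_rewrite 1 [hB]
    rw [add_assoc, ← add_smul]
    congr 2
    field_simp
    ring
  have hr2 : 0 ≤ (β t 0 - a 0) / (c 0 - a 0) := div_nonneg (by linarith) (by linarith)
  change _ = modelTau 0 A N
  rw [hN2, modelTau_zero_add_smul hr2, add_sub_cancel, h3, ← ENNReal.ofReal_mul hr2,
    div_mul_cancel₀ _ (by linarith), lpPlaneInf_tau_of_ll (hab.trans_le hbM)]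

/-! ### Triangles with a median in the model spaces -/

/-- `A B C` is a triangle in the model space of curvature `K` with sides `AB`, `BC`, `AC` of lengths
`x - y`, `2 * h`, `x + y`, and `N` is the midpoint of the side `BC`. -/
structure IsModelMedian (K x y h : ℝ) (A B C N : Plane) : Prop where
  tau_ab : modelTau K A B = ENNReal.ofReal (x - y)
  tau_bc : modelTau K B C = ENNReal.ofReal (2 * h)
  tau_ac : modelTau K A C = ENNReal.ofReal (x + y)
  le_bn : ModelLE K B N
  le_nc : ModelLE K N C
  tau_bn : modelTau K B N = ENNReal.ofReal h
  tau_nc : modelTau K N C = ENNReal.ofReal h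

theorem gudermann_strictMono : StrictMono gudermann :=
  arctan_strictMono.comp sinh_strictMono

theorem gudermann_zero : gudermann 0 = 0 := by simp [gudermann]

theorem cos_gudermann (s : ℝ) : cos (gudermann s) = 1 / cosh s := by
  rw [gudermann, cos_arctan, add_comm, ← cosh_sq, sqrt_sq (cosh_pos s).le]

theorem sin_gudermann (s : ℝ) : sin (gudermann s) = sinh s / cosh s := by
  rw [gudermann, sin_arctan, add_comm, ← cosh_sq, sqrt_sq (cosh_pos s).le]

theorem ModelLL.le {K : ℝ} {x y : Plane} (h : ModelLL K x y) : ModelLE K x y :=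
  le_of_lt (show |confSpace K y - confSpace K x| < confTime K y - confTime K x from h)

theorem modelTau_of_pos {K : ℝ} (hK : 0 < K) {x y : Plane} (h : ModelLL K x y) :
    modelTau K x y = ENNReal.ofReal (arcosh (deSitterProd x y) / √K) := by
  rw [modelTau, if_pos h, if_pos hK]

theorem modelTau_of_neg {K : ℝ} (hK : K < 0) {x y : Plane} (h : ModelLL K x y)
    (h' : confTime K y - confTime K x ≤ π - |confSpace K x + confSpace K y|) :
    modelTau K x y = ENNReal.ofReal (arccos (antiDeSitterProd x y) / √(-K)) := by
  rw [modelTau, if_pos h, if_neg hK.not_gt, if_pos hK, if_pos h']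

/-- In de Sitter space a triangle with given side lengths is found by placing the side `BC` on the
time axis, which is a geodesic, with midpoint `0`. The ambient products of `A` with `B` and `C` are
then two linear equations for the ambient coordinates of `A`. -/
theorem exists_isModelMedian_of_pos {K x y h : ℝ} (hK : 0 < K) (hh : 0 < h) (hy : h < y)
    (hx : y < x) : ∃ A B C N : Plane,
      IsModelMedian K (x / √K) (y / √K) (h / √K) A B C N ∧
      modelTau K A N = ENNReal.ofReal (arcosh (cosh x * cosh y / cosh h) / √K) := by
  have sh : 0 < sinh h := sinh_pos_iff.2 hh
  have sy : sinh h < sinh y := sinh_lt_sinh.2 hy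
  have sx : sinh y < sinh x := sinh_lt_sinh.2 hx
  have ch := cosh_pos h
  have cy := cosh_pos y
  have cx := cosh_pos x
  have ex := cosh_sq x
  have ey := cosh_sq y
  have eh := cosh_sq h
  set S := sinh x * sinh y / sinh h with hS
  set P := cosh x * cosh y / cosh h with hP
  have hP0 : 0 < P := by positivity
  have hSh : S * sinh h = sinh x * sinh y := by rw [hS]; field_simp
  have hPh : P * cosh h = cosh x * cosh y := by rw [hP]; field_simp
  have hSlt : sinh h < S := by
    rw [hS, lt_div_iff₀ sh]
    nlinarith
  set s := arsinh (-S) with hs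
  have hss : sinh s = -S := sinh_arsinh _
  have hsh : s < -h := by
    rw [← sinh_lt_sinh, hss, sinh_neg]
    linarith
  have hcs := cosh_pos s
  have hcs2 : cosh s ^ 2 = S ^ 2 + 1 := by rw [cosh_sq, hss]; ring
  have hPle : P ≤ cosh s := by
    refine (pow_le_pow_iff_left₀ hP0.le hcs.le two_ne_zero).1 ?_
    rw [hcs2, hP, hS, div_pow, div_pow, mul_pow, mul_pow, ex, ey, eh,
      ← sub_nonneg]
    have : (sinh x ^ 2 * sinh y ^ 2) / sinh h ^ 2 + 1 -
        (sinh x ^ 2 + 1) * (sinh y ^ 2 + 1) / (sinh h ^ 2 + 1) =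
        (sinh x ^ 2 - sinh h ^ 2) * (sinh y ^ 2 - sinh h ^ 2) /
          (sinh h ^ 2 * (sinh h ^ 2 + 1)) := by
      field_simp
      ring
    rw [this]
    have h1 : 0 ≤ sinh y ^ 2 - sinh h ^ 2 := by nlinarith
    have h2 : 0 ≤ sinh x ^ 2 - sinh h ^ 2 := by nlinarith
    positivity
  set φ := arccos (P / cosh s) with hφ
  have hcφ : cosh s * cos φ = P := by
    rw [hφ, cos_arccos (by linarith [div_pos hP0 hcs]) ((div_le_one hcs).2 hPle)]
    field_simp
  have hφ0 : 0 ≤ φ := arccos_nonneg _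
  have hφ1 : φ ≤ π := arccos_le_pi _
  have hg1 : gudermann s < gudermann (-h) := gudermann_strictMono hsh
  have hg2 : gudermann (-h) < gudermann 0 := gudermann_strictMono (by linarith)
  have hg3 : gudermann 0 < gudermann h := gudermann_strictMono hh
  have hφg : φ < gudermann (-h) - gudermann s := by
    have h1 := neg_pi_div_two_lt_arctan (sinh s)
    have h2 := arctan_lt_pi_div_two (sinh (-h))
    refine (strictAntiOn_cos.lt_iff_gt ⟨by linarith, ?_⟩ ⟨hφ0, hφ1⟩).1 ?_
    · unfold gudermann
      linarith
    · rw [cos_sub, cos_gudermann, cos_gudermann, sin_gudermann, sin_gudermann, cosh_neg, sinh_neg,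
        hss]
      have h3 : cosh (x - y) = cosh h * (cosh s * cos φ) - S * sinh h := by
        rw [hcφ, cosh_sub, hSh, mul_comm (cosh h), hPh]
      have h4 : 1 < cosh (x - y) := one_lt_cosh.2 (by linarith)
      rw [div_mul_div_comm, div_mul_div_comm, ← add_div, mul_comm (cosh h),
        div_lt_iff₀ (by positivity)]
      linarith
  have llAxis {a b : ℝ} (hab : a < b) : ModelLL K !₂[a, 0] !₂[b, 0] := by
    have := gudermann_strictMono hab
    simp [ModelLL, confSpace, confTime, hK, hK.not_gt, this]
  have tauAxis {a b : ℝ} (hab : a < b) :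
      modelTau K !₂[a, 0] !₂[b, 0] = ENNReal.ofReal ((b - a) / √K) := by
    rw [modelTau_of_pos hK (llAxis hab)]
    have : deSitterProd !₂[a, 0] !₂[b, 0] = cosh (b - a) := by
      simp [deSitterProd, cosh_sub]
      ring
    rw [this, arcosh_cosh (by linarith)]
  have llA {b : ℝ} (hb : gudermann (-h) ≤ gudermann b) : ModelLL K !₂[s, φ] !₂[b, 0] := by
    simp only [ModelLL, confSpace, confTime, hK, hK.not_gt, if_true, if_false]
    simp [abs_of_nonneg hφ0]
    linarith
  have prodA (b : ℝ) : deSitterProd !₂[s, φ] !₂[b, 0] = P * cosh b + S * sinh b := by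
    simp [deSitterProd, hss, ← hcφ]
    ring
  refine ⟨!₂[s, φ], !₂[-h, 0], !₂[h, 0], !₂[0, 0], ⟨?_, ?_, ?_, (llAxis (by linarith)).le,
    (llAxis hh).le, ?_, ?_⟩, ?_⟩
  · rw [modelTau_of_pos hK (llA le_rfl), prodA, cosh_neg, sinh_neg, mul_neg, hPh, hSh,
      ← sub_eq_add_neg, ← cosh_sub, arcosh_cosh (by linarith), sub_div]
  · rw [tauAxis (by linarith)]
    congr 1
    ring
  · rw [modelTau_of_pos hK (llA (by linarith)), prodA, hPh, hSh, ← cosh_add,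
      arcosh_cosh (by linarith), add_div]
  · rw [tauAxis (by linarith)]
    congr 1
    ring
  · rw [tauAxis (by linarith), sub_zero]
  · rw [modelTau_of_pos hK (llA (by linarith)), prodA]
    simp

/-- The analogue of `exists_isModelMedian_of_pos` for anti-de Sitter space, where the size of the
triangle has to be bounded. -/
theorem exists_isModelMedian_of_neg {K x y h : ℝ} (hK : K < 0) (hh : 0 < h) (hy : h < y)
    (hx : y < x) (hx2 : x < π / 2) : ∃ A B C N : Plane,
      IsModelMedian K (x / √(-K)) (y / √(-K)) (h / √(-K)) A B C N ∧
      modelTau K A N = ENNReal.ofReal (arccos (cos x * cos y / cos h) / √(-K)) := by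
  have sh : 0 < sin h := sin_pos_of_pos_of_lt_pi hh (by linarith)
  have sy : sin h < sin y := sin_lt_sin_of_lt_of_le_pi_div_two (by linarith) (by linarith) hy
  have sx : sin y < sin x := sin_lt_sin_of_lt_of_le_pi_div_two (by linarith) hx2.le hx
  have cx : 0 < cos x := cos_pos_of_mem_Ioo ⟨by linarith, hx2⟩
  have cy : 0 < cos y := cos_pos_of_mem_Ioo ⟨by linarith, by linarith⟩
  have ch : 0 < cos h := cos_pos_of_mem_Ioo ⟨by linarith, by linarith⟩
  have ex := cos_sq' x
  have ey := cos_sq' y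
  have eh := cos_sq' h
  set S := sin x * sin y / sin h with hS
  set P := cos x * cos y / cos h with hP
  have hP0 : 0 < P := by positivity
  have hS0 : 0 < S := by
    have : 0 < sin y := by linarith
    have : 0 < sin x := by linarith
    positivity
  have hSh : S * sin h = sin x * sin y := by rw [hS]; field_simp
  have hPh : P * cos h = cos x * cos y := by rw [hP]; field_simp
  have hone : 1 ≤ P ^ 2 + S ^ 2 := by
    rw [hP, hS, div_pow, div_pow, mul_pow, mul_pow, ex, ey, eh, ← sub_nonneg]
    have e1 : 0 < 1 - sin h ^ 2 := by rw [← eh]; positivity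
    have : (1 - sin x ^ 2) * (1 - sin y ^ 2) / (1 - sin h ^ 2) +
        (sin x ^ 2 * sin y ^ 2) / sin h ^ 2 - 1 =
        (sin x ^ 2 - sin h ^ 2) * (sin y ^ 2 - sin h ^ 2) /
          (sin h ^ 2 * (1 - sin h ^ 2)) := by
      field_simp
      ring
    rw [this]
    have h1 : 0 ≤ sin y ^ 2 - sin h ^ 2 := by nlinarith
    have h2 : 0 ≤ sin x ^ 2 - sin h ^ 2 := by nlinarith
    positivity
  set c := √(P ^ 2 + S ^ 2) with hc
  have hc1 : 1 ≤ c := one_le_sqrt.2 hone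
  have hc0 : 0 < c := by linarith
  have hc2 : c ^ 2 = P ^ 2 + S ^ 2 := sq_sqrt (by positivity)
  -- The point `A` has time coordinate `-s` and space coordinate `r`.
  set r := arcosh c with hr
  have hcr : cosh r = c := cosh_arcosh hc1
  have hr0 : 0 ≤ r := arcosh_nonneg hc1
  set s := arctan (S / P) with hs
  have hsq : √(1 + (S / P) ^ 2) = c / P := by
    rw [show 1 + (S / P) ^ 2 = (c / P) ^ 2 by rw [div_pow S, div_pow c, hc2]; field_simp,
      sqrt_sq (by positivity)]
  have hcs : c * cos s = P := by
    rw [hs, cos_arctan, hsq]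
    field_simp
  have hsn : c * sin s = S := by
    rw [hs, sin_arctan, hsq]
    field_simp
  have hs2 : s < π / 2 := arctan_lt_pi_div_two _
  have prodcos (b : ℝ) : c * cos (b + s) = P * cos b - S * sin b := by
    rw [cos_add, ← hcs, ← hsn]
    ring
  have hhs : h < s := by
    have h1 : arctan (tan h) = h := arctan_tan (by linarith) (by linarith)
    rw [← h1, hs]
    refine arctan_strictMono ?_
    have h2 : P < cos h := by
      have h3 : cos x < cos y := cos_lt_cos_of_nonneg_of_le_pi_div_two (by linarith) hx2.le hx
      have h4 : cos y < cos h :=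
        cos_lt_cos_of_nonneg_of_le_pi_div_two (by linarith) (by linarith) hy
      rw [hP, div_lt_iff₀ ch]
      exact mul_lt_mul'' (h3.trans h4) h4 cx.le cy.le
    have h5 : sin h < S := by
      rw [hS, lt_div_iff₀ sh]
      exact mul_lt_mul'' (sy.trans sx) sy sh.le sh.le
    rw [tan_eq_sin_div_cos]
    exact div_lt_div₀ h5 h2.le hS0.le hP0
  have hg0 : 0 ≤ gudermann r := by
    rw [← gudermann_zero]
    exact gudermann_strictMono.monotone hr0
  have hg2 : gudermann r < π / 2 := arctan_lt_pi_div_two _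
  have hgs : gudermann r < -h + s := by
    refine (strictAntiOn_cos.lt_iff_gt ⟨by linarith, by linarith⟩
      ⟨hg0, by linarith⟩).1 ?_
    rw [cos_gudermann, hcr, lt_div_iff₀ hc0, mul_comm, prodcos, cos_neg, sin_neg, mul_neg,
      sub_neg_eq_add, hPh, hSh, ← cos_sub, ← cos_zero]
    exact cos_lt_cos_of_nonneg_of_le_pi le_rfl (by linarith) (by linarith)
  have hgs' : h + s ≤ π - gudermann r := by
    refine (strictAntiOn_cos.le_iff_ge ⟨by linarith, by linarith⟩
      ⟨by linarith, by linarith⟩).1 ?_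
    rw [cos_pi_sub, cos_gudermann, hcr, ← neg_div, div_le_iff₀ hc0, mul_comm, prodcos, hPh, hSh,
      ← cos_add]
    exact neg_one_le_cos _
  have llAxis {a b : ℝ} (hab : a < b) : ModelLL K !₂[a, 0] !₂[b, 0] := by
    simp [ModelLL, confSpace, confTime, hK.not_gt, hab]
  have tauAxis {a b : ℝ} (hab : a < b) (hb : b - a ≤ π) :
      modelTau K !₂[a, 0] !₂[b, 0] = ENNReal.ofReal ((b - a) / √(-K)) := by
    rw [modelTau_of_neg hK (llAxis hab)
      (by simpa [confSpace, confTime, hK, hK.not_gt, gudermann_zero] using hb)]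
    have : antiDeSitterProd !₂[a, 0] !₂[b, 0] = cos (b - a) := by
      simp [antiDeSitterProd]
    rw [this, arccos_cos (by linarith) hb]
  have tauA {b : ℝ} (hb : -h ≤ b) (hb' : b ≤ h) : modelTau K !₂[-s, r] !₂[b, 0] =
      ENNReal.ofReal (arccos (P * cos b - S * sin b) / √(-K)) := by
    rw [modelTau_of_neg hK]
    · have : antiDeSitterProd !₂[-s, r] !₂[b, 0] = P * cos b - S * sin b := by
        simp [antiDeSitterProd, hcr, ← prodcos]
      rw [this]
    · simp only [ModelLL, confSpace, confTime, hK, hK.not_gt, if_true, if_false]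
      simp [gudermann_zero, abs_of_nonneg hg0]
      linarith
    · simp [confSpace, confTime, hK, hK.not_gt, gudermann_zero, abs_of_nonneg hg0]
      linarith
  refine ⟨!₂[-s, r], !₂[-h, 0], !₂[h, 0], !₂[0, 0], ⟨?_, ?_, ?_, (llAxis (by linarith)).le,
    (llAxis hh).le, ?_, ?_⟩, ?_⟩
  · rw [tauA le_rfl (by linarith), cos_neg, sin_neg, mul_neg, sub_neg_eq_add, hPh, hSh, ← cos_sub,
      arccos_cos (by linarith) (by linarith), sub_div]
  · rw [tauAxis (by linarith) (by linarith)]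
    congr 1
    ring
  · rw [tauA (by linarith) le_rfl, hPh, hSh, ← cos_add, arccos_cos (by linarith) (by linarith),
      add_div]
  · rw [tauAxis (by linarith) (by linarith)]
    congr 1
    ring
  · rw [tauAxis (by linarith) (by linarith), sub_zero]
  · rw [tauA (by linarith) hh.le]
    simp

theorem exists_isModelMedian_zero {x y h : ℝ} (hh : 0 < h) (hy : h < y) (hx : y < x) :
    ∃ A B C N : Plane, IsModelMedian 0 x y h A B C N ∧
      modelTau 0 A N = ENNReal.ofReal √(x ^ 2 + y ^ 2 - h ^ 2) := by
  have hn : 0 ≤ (x ^ 2 - h ^ 2) * (y ^ 2 - h ^ 2) :=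
    mul_nonneg (by nlinarith) (by nlinarith)
  set s := x * y / h with hs
  set φ := √((x ^ 2 - h ^ 2) * (y ^ 2 - h ^ 2)) / h with hφ
  have hsh : s * h = x * y := by rw [hs]; field_simp
  have hφ0 : 0 ≤ φ := by positivity
  have hφ2 : φ ^ 2 = s ^ 2 + h ^ 2 - x ^ 2 - y ^ 2 := by
    rw [hφ, div_pow, sq_sqrt hn, hs]
    field_simp
    ring
  have hs1 : h < s := by
    rw [hs, lt_div_iff₀ hh]
    nlinarith
  have hφs : φ < s - h := by
    refine (pow_lt_pow_iff_left₀ hφ0 (by linarith) two_ne_zero).1 ?_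
    nlinarith
  have leA {b : ℝ} (hb : -h ≤ b) : MinkowskiLE !₂[-s, φ] !₂[b, 0] := by
    simp [MinkowskiLE, abs_of_nonneg hφ0]
    linarith
  have leAxis {a b : ℝ} (hab : a ≤ b) : MinkowskiLE !₂[a, 0] !₂[b, 0] := by
    simpa [MinkowskiLE] using hab
  have tauA {b : ℝ} (hb : -h ≤ b) :
      modelTau 0 !₂[-s, φ] !₂[b, 0] = ENNReal.ofReal √((b + s) ^ 2 - φ ^ 2) := by
    rw [modelTau_zero_of_le (leA hb)]
    simp [minkowskiProd]
    ring_nf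
  have tauAxis {a b : ℝ} (hab : a ≤ b) :
      modelTau 0 !₂[a, 0] !₂[b, 0] = ENNReal.ofReal (b - a) := by
    rw [modelTau_zero_of_le (leAxis hab)]
    simp [minkowskiProd, sqrt_mul_self (sub_nonneg.2 hab)]
  refine ⟨!₂[-s, φ], !₂[-h, 0], !₂[h, 0], !₂[0, 0], ⟨?_, ?_, ?_,
    (modelLE_zero _ _).2 (leAxis (by linarith)), (modelLE_zero _ _).2 (leAxis hh.le), ?_, ?_⟩, ?_⟩
  · rw [tauA le_rfl, show (-h + s) ^ 2 - φ ^ 2 = (x - y) ^ 2 by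
      linear_combination -2 * hsh - hφ2, sqrt_sq (by linarith)]
  · rw [tauAxis (by linarith)]
    congr 1
    ring
  · rw [tauA (by linarith), show (h + s) ^ 2 - φ ^ 2 = (x + y) ^ 2 by
      linear_combination 2 * hsh - hφ2, sqrt_sq (by linarith)]
  · rw [tauAxis (by linarith)]
    congr 1
    ring
  · rw [tauAxis hh.le, sub_zero]
  · rw [tauA (by linarith), hφ2]
    ring_nf

/-! ### Small triangles -/

/-- The common second order expansion of `cosh x * cosh y - cosh h * cosh m` (with `σ = 1`) and
`cos x * cos y - cos h * cos m` (with `σ = -1`), as the four arguments are scaled to `0`. -/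
theorem tendsto_mul_sub_mul_div_sq {f g : ℝ → ℝ} {σ : ℝ} (hg : HasDerivAt g 1 0) (hg0 : g 0 = 0)
    (hfg : ∀ z, f z = 1 + 2 * σ * g (z / 2) ^ 2) (x y h m : ℝ) :
    Tendsto (fun ε => (f (ε * x) * f (ε * y) - f (ε * h) * f (ε * m)) / ε ^ 2) (𝓝[>] 0)
      (𝓝 (σ / 2 * (x ^ 2 + y ^ 2 - (h ^ 2 + m ^ 2)))) := by
  have hlin (z : ℝ) : Tendsto (fun ε => g (ε * z / 2) / ε) (𝓝[>] 0) (𝓝 (z / 2)) := by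
    have h1 : HasDerivAt (fun ε : ℝ => ε * z / 2) (z / 2) 0 := by
      simpa using ((hasDerivAt_id (0 : ℝ)).mul_const z).div_const 2
    have h2 : HasDerivAt (fun ε : ℝ => g (ε * z / 2)) (1 * (z / 2)) 0 :=
      HasDerivAt.comp (0 : ℝ) (by simpa using hg) h1
    rw [one_mul, hasDerivAt_iff_tendsto_slope_zero] at h2
    refine (h2.mono_left (nhdsWithin_mono 0 fun ε (hε : 0 < ε) => hε.ne')).congr fun ε => ?_
    simp [hg0, div_eq_inv_mul]
  have hquad (z : ℝ) :
      Tendsto (fun ε => (f (ε * z) - 1) / ε ^ 2) (𝓝[>] 0) (𝓝 (2 * σ * (z / 2) ^ 2)) := by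
    refine (((hlin z).pow 2).const_mul (2 * σ)).congr fun ε => ?_
    rw [hfg, div_pow]
    ring
  have hone (z : ℝ) : Tendsto (fun ε => f (ε * z)) (𝓝[>] 0) (𝓝 1) := by
    have h1 : ContinuousAt (fun ε : ℝ => g (ε * z / 2)) 0 :=
      ContinuousAt.comp (by simpa using hg.continuousAt) (by fun_prop)
    have h2 : Tendsto (fun ε : ℝ => g (ε * z / 2)) (𝓝[>] 0) (𝓝 0) := by
      simpa [ContinuousAt, hg0] using h1.mono_left nhdsWithin_le_nhds
    have h3 := ((h2.pow 2).const_mul (2 * σ)).const_add 1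
    simp only [ne_eq, OfNat.ofNat_ne_zero, not_false_eq_true, zero_pow, mul_zero, add_zero] at h3
    exact h3.congr fun ε => (hfg _).symm
  have key := (((hone x).mul (hquad y)).add (hquad x)).sub
    (((hone h).mul (hquad m)).add (hquad h))
  rw [show σ / 2 * (x ^ 2 + y ^ 2 - (h ^ 2 + m ^ 2)) =
    1 * (2 * σ * (y / 2) ^ 2) + 2 * σ * (x / 2) ^ 2 -
      (1 * (2 * σ * (m / 2) ^ 2) + 2 * σ * (h / 2) ^ 2) by ring]
  exact key.congr fun ε => by ring

theorem tendsto_cosh_mul_sub_div_sq (x y h m : ℝ) :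
    Tendsto (fun ε => (cosh (ε * x) * cosh (ε * y) - cosh (ε * h) * cosh (ε * m)) / ε ^ 2) (𝓝[>] 0)
      (𝓝 (1 / 2 * (x ^ 2 + y ^ 2 - (h ^ 2 + m ^ 2)))) :=
  tendsto_mul_sub_mul_div_sq (g := sinh) (by simpa using hasDerivAt_sinh 0) sinh_zero
    (fun z => by
      have h1 := cosh_two_mul (z / 2)
      have h2 := cosh_sq (z / 2)
      rw [mul_div_cancel₀ z two_ne_zero] at h1
      linarith) x y h m

theorem tendsto_cos_mul_sub_div_sq (x y h m : ℝ) :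
    Tendsto (fun ε => (cos (ε * x) * cos (ε * y) - cos (ε * h) * cos (ε * m)) / ε ^ 2) (𝓝[>] 0)
      (𝓝 (-1 / 2 * (x ^ 2 + y ^ 2 - (h ^ 2 + m ^ 2)))) :=
  tendsto_mul_sub_mul_div_sq (g := sin) (by simpa using hasDerivAt_sin 0) sin_zero
    (fun z => by
      have h1 := cos_two_mul (z / 2)
      have h2 := cos_sq' (z / 2)
      rw [mul_div_cancel₀ z two_ne_zero] at h1
      linarith) x y h m

/-- Small triangles in any model space have a median that compares with given lengths in the same
way as the median of the Minkowski plane, whose square is `x ^ 2 + y ^ 2 - h ^ 2`. -/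
theorem eventually_exists_isModelMedian (K : ℝ) {x y h m : ℝ} (hh : 0 < h) (hy : h < y)
    (hx : y < x) (hm : 0 < m) : ∀ᶠ ε in 𝓝[>] (0 : ℝ), ∃ A B C N : Plane,
      IsModelMedian K (ε * x) (ε * y) (ε * h) A B C N ∧
      (x ^ 2 + y ^ 2 < h ^ 2 + m ^ 2 → modelTau K A N < ENNReal.ofReal (ε * m)) ∧
      (h ^ 2 + m ^ 2 < x ^ 2 + y ^ 2 → ENNReal.ofReal (ε * m) < modelTau K A N) := by
  have hpos : ∀ᶠ ε in 𝓝[>] (0 : ℝ), 0 < ε := eventually_mem_nhdsWithin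
  rcases lt_trichotomy K 0 with hK | rfl | hK
  · set k := √(-K) with hk
    have hk0 : 0 < k := sqrt_pos.2 (by linarith)
    have hlim := tendsto_cos_mul_sub_div_sq (k * x) (k * y) (k * h) (k * m)
    have hsmall (z : ℝ) : ∀ᶠ ε in 𝓝[>] (0 : ℝ), ε * z < π / 2 := by
      have : Tendsto (fun ε : ℝ => ε * z) (𝓝[>] 0) (𝓝 0) := by
        have : ContinuousAt (fun ε : ℝ => ε * z) 0 := by fun_prop
        simpa [ContinuousAt] using this.mono_left nhdsWithin_le_nhds
      exact this.eventually_lt_const (by positivity)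
    have e1 : x ^ 2 + y ^ 2 < h ^ 2 + m ^ 2 → ∀ᶠ ε in 𝓝[>] (0 : ℝ),
        0 < (cos (ε * (k * x)) * cos (ε * (k * y)) - cos (ε * (k * h)) * cos (ε * (k * m))) / ε ^ 2 :=
      fun hlt => hlim.eventually_const_lt (by nlinarith [mul_pos hk0 hk0])
    have e2 : h ^ 2 + m ^ 2 < x ^ 2 + y ^ 2 → ∀ᶠ ε in 𝓝[>] (0 : ℝ),
        (cos (ε * (k * x)) * cos (ε * (k * y)) - cos (ε * (k * h)) * cos (ε * (k * m))) / ε ^ 2 < 0 :=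
      fun hlt => hlim.eventually_lt_const (by nlinarith [mul_pos hk0 hk0])
    rw [← eventually_imp_distrib_left] at e1 e2
    filter_upwards [hpos, hsmall (k * x), hsmall (k * m), e1, e2] with ε hε hεx hεm he1 he2
    have hεk : 0 < ε * k := mul_pos hε hk0
    obtain ⟨A, B, C, N, hT, hN⟩ := exists_isModelMedian_of_neg (x := ε * (k * x))
      (y := ε * (k * y)) (h := ε * (k * h)) hK (by positivity)
      (by nlinarith) (by nlinarith) hεx
    have hdiv (z : ℝ) : ε * (k * z) / √(-K) = ε * z := by
      rw [← hk]
      field_simp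
    rw [hdiv, hdiv, hdiv] at hT
    have hεh : ε * (k * h) < ε * (k * x) := by nlinarith
    have hεh0 : 0 < ε * (k * h) := by positivity
    have hεm0 : 0 < ε * (k * m) := by positivity
    have ch : 0 < cos (ε * (k * h)) := cos_pos_of_mem_Ioo ⟨by linarith, by linarith⟩
    have hle : -1 ≤ cos (ε * (k * x)) * cos (ε * (k * y)) / cos (ε * (k * h)) := by
      have c1 : 0 < cos (ε * (k * x)) := cos_pos_of_mem_Ioo ⟨by linarith, by linarith⟩
      have c2 : 0 < cos (ε * (k * y)) := cos_pos_of_mem_Ioo ⟨by nlinarith, by nlinarith⟩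
      have : 0 < cos (ε * (k * x)) * cos (ε * (k * y)) / cos (ε * (k * h)) := by positivity
      linarith
    have hle' : cos (ε * (k * x)) * cos (ε * (k * y)) / cos (ε * (k * h)) ≤ 1 := by
      rw [div_le_one ch]
      have c2 : 0 < cos (ε * (k * x)) := cos_pos_of_mem_Ioo ⟨by linarith, by linarith⟩
      have c3 := cos_le_cos_of_nonneg_of_le_pi hεh0.le (by linarith) hεh.le
      have := cos_le_one (ε * (k * y))
      nlinarith
    have harc := arccos_cos hεm0.le (by linarith)
    refine ⟨A, B, C, N, hT, fun hlt => ?_, fun hlt => ?_⟩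
    · rw [hN, ENNReal.ofReal_lt_ofReal_iff (by positivity), ← hdiv m]
      refine div_lt_div_of_pos_right ?_ hk0
      rw [← harc]
      refine strictAntiOn_arccos ⟨neg_one_le_cos _, cos_le_one _⟩ ⟨hle, hle'⟩ ?_
      have := (div_pos_iff_of_pos_right (pow_pos hε 2)).1 (he1 hlt)
      rw [lt_div_iff₀ ch]
      linarith
    · have hlt' : ε * (k * m) <
          arccos (cos (ε * (k * x)) * cos (ε * (k * y)) / cos (ε * (k * h))) := by
        rw [← harc]
        refine strictAntiOn_arccos ⟨hle, hle'⟩ ⟨neg_one_le_cos _, cos_le_one _⟩ ?_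
        have := neg_of_div_neg_left (he2 hlt) (pow_pos hε 2).le
        rw [div_lt_iff₀ ch]
        linarith
      rw [hN, ENNReal.ofReal_lt_ofReal_iff (div_pos (hεm0.trans hlt') hk0), ← hdiv m]
      exact div_lt_div_of_pos_right hlt' hk0
  · filter_upwards [hpos] with ε hε
    obtain ⟨A, B, C, N, hT, hN⟩ := exists_isModelMedian_zero (x := ε * x) (y := ε * y)
      (h := ε * h) (by positivity) (by nlinarith) (by nlinarith)
    have e : (ε * x) ^ 2 + (ε * y) ^ 2 - (ε * h) ^ 2 = ε ^ 2 * (x ^ 2 + y ^ 2 - h ^ 2) := by ring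
    have h0 : 0 < x ^ 2 + y ^ 2 - h ^ 2 := by nlinarith
    rw [e, sqrt_mul (by positivity), sqrt_sq hε.le] at hN
    refine ⟨A, B, C, N, hT, fun hlt => ?_, fun hlt => ?_⟩
    · rw [hN, ENNReal.ofReal_lt_ofReal_iff (by positivity), mul_lt_mul_iff_right₀ hε,
        sqrt_lt' hm]
      linarith
    · rw [hN, ENNReal.ofReal_lt_ofReal_iff (mul_pos hε (sqrt_pos.2 h0)), mul_lt_mul_iff_right₀ hε]
      exact lt_sqrt_of_sq_lt (by linarith)
  · set k := √K with hk
    have hk0 : 0 < k := sqrt_pos.2 hK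
    have hlim := tendsto_cosh_mul_sub_div_sq (k * x) (k * y) (k * h) (k * m)
    have e1 : x ^ 2 + y ^ 2 < h ^ 2 + m ^ 2 → ∀ᶠ ε in 𝓝[>] (0 : ℝ),
        (cosh (ε * (k * x)) * cosh (ε * (k * y)) -
          cosh (ε * (k * h)) * cosh (ε * (k * m))) / ε ^ 2 < 0 :=
      fun hlt => hlim.eventually_lt_const (by nlinarith [mul_pos hk0 hk0])
    have e2 : h ^ 2 + m ^ 2 < x ^ 2 + y ^ 2 → ∀ᶠ ε in 𝓝[>] (0 : ℝ),
        0 < (cosh (ε * (k * x)) * cosh (ε * (k * y)) -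
          cosh (ε * (k * h)) * cosh (ε * (k * m))) / ε ^ 2 :=
      fun hlt => hlim.eventually_const_lt (by nlinarith [mul_pos hk0 hk0])
    rw [← eventually_imp_distrib_left] at e1 e2
    filter_upwards [hpos, e1, e2] with ε hε he1 he2
    have hεk : 0 < ε * k := mul_pos hε hk0
    obtain ⟨A, B, C, N, hT, hN⟩ := exists_isModelMedian_of_pos (x := ε * (k * x))
      (y := ε * (k * y)) (h := ε * (k * h)) hK (by positivity) (by nlinarith) (by nlinarith)
    have hdiv (z : ℝ) : ε * (k * z) / √K = ε * z := by
      rw [← hk]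
      field_simp
    rw [hdiv, hdiv, hdiv] at hT
    have hεm0 : 0 < ε * (k * m) := by positivity
    have c1 := cosh_pos (ε * (k * x))
    have c2 := cosh_pos (ε * (k * y))
    have c3 := cosh_pos (ε * (k * h))
    have hP : 0 < cosh (ε * (k * x)) * cosh (ε * (k * y)) / cosh (ε * (k * h)) := by positivity
    have harc := arcosh_cosh hεm0.le
    refine ⟨A, B, C, N, hT, fun hlt => ?_, fun hlt => ?_⟩
    · rw [hN, ENNReal.ofReal_lt_ofReal_iff (by positivity), ← hdiv m]
      refine div_lt_div_of_pos_right ?_ hk0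
      rw [← harc, arcosh_lt_arcosh hP (cosh_pos _), div_lt_iff₀ c3]
      have := neg_of_div_neg_left (he1 hlt) (pow_pos hε 2).le
      linarith
    · have hlt' : ε * (k * m) <
          arcosh (cosh (ε * (k * x)) * cosh (ε * (k * y)) / cosh (ε * (k * h))) := by
        rw [← harc, arcosh_lt_arcosh (cosh_pos _) hP, lt_div_iff₀ c3]
        have := (div_pos_iff_of_pos_right (pow_pos hε 2)).1 (he2 hlt)
        linarith
      rw [hN, ENNReal.ofReal_lt_ofReal_iff (div_pos (hεm0.trans hlt') hk0), ← hdiv m]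
      exact div_lt_div_of_pos_right hlt' hk0

/-! ### Unbounded curvature for `p ≠ 2` -/

theorem lpPlane_tau_add_smul {p ε : ℝ} (hp : 0 < p) (hε : 0 ≤ ε) (x v w : Plane) :
    (lpPlane p).tau (x + ε • v) (x + ε • w) = ENNReal.ofReal (ε * lorentzNorm p (w - v)) := by
  simp only [lpPlane]
  rw [add_sub_add_left_eq_sub, ← smul_sub, lorentzNorm_smul hp hε]

theorem minkowskiLL_add_smul {ε : ℝ} (hε : 0 < ε) (x : Plane) {v w : Plane}
    (h : |(w - v) 1| < (w - v) 0) : MinkowskiLL (x + ε • v) (x + ε • w) := by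
  simp only [MinkowskiLL, PiLp.add_apply, PiLp.smul_apply, smul_eq_mul, add_sub_add_left_eq_sub,
    ← mul_sub, abs_mul, abs_of_pos hε]
  exact mul_lt_mul_of_pos_left h hε

/-- If `v` and `w` are timelike vectors such that `v`, `2 • w` satisfy the strict reverse triangle
inequality, then each neighbourhood of a point contains a small triangle with side vectors parallel to
`v`, `2 • w` and `v + 2 • w`, and a comparison triangle. Its median `v + w` is longer or shorter than
the comparison median according to the sign of the defect of the parallelogram identity. -/
theorem exists_triangle_of_parallelogram_defect {p : ℝ} (hp : 0 < p) (x : Plane) (K : ℝ)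
    {U : Set Plane} (hU : U ∈ 𝓝 x) {v w : Plane} (hv : |v 1| < v 0) (hw : |w 1| < w 0)
    (hpos : 0 < lorentzNorm p v) (hwpos : 0 < lorentzNorm p w) (hupos : 0 < lorentzNorm p (v + w))
    (hadd : lorentzNorm p v + 2 * lorentzNorm p w < lorentzNorm p (v + (2 : ℝ) • w)) :
    ∃ (a b c : Plane) (α β γ : ℝ → Plane) (A B C M N : Plane),
      IsTimelikeTriangle (lpPlane p) U a b c α β γ ∧ (lpPlane p).tau a c < modelDiam K ∧
      IsComparisonTriangle (lpPlane p) K a b c A B C ∧ M ∈ β '' Icc 0 1 ∧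
      IsComparisonPoint (lpPlane p) K b c M B C N ∧
      (lorentzNorm p v ^ 2 + lorentzNorm p (v + (2 : ℝ) • w) ^ 2 <
        2 * (lorentzNorm p (v + w) ^ 2 + lorentzNorm p w ^ 2) →
        (modelSpace K).tau A N < (lpPlane p).tau a M) ∧
      (2 * (lorentzNorm p (v + w) ^ 2 + lorentzNorm p w ^ 2) <
        lorentzNorm p v ^ 2 + lorentzNorm p (v + (2 : ℝ) • w) ^ 2 →
        (lpPlane p).tau a M < (modelSpace K).tau A N) := by
  obtain ⟨ρ, hρ, hρU⟩ := Metric.mem_nhds_iff.1 hU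
  have hlim (z : Plane) : ∀ᶠ ε in 𝓝[>] (0 : ℝ), x + ε • z ∈ Metric.ball x ρ := by
    have h1 : ContinuousAt (fun ε : ℝ => x + ε • z) 0 := by fun_prop
    have h2 : Tendsto (fun ε : ℝ => x + ε • z) (𝓝[>] 0) (𝓝 x) := by
      simpa [ContinuousAt] using h1.mono_left nhdsWithin_le_nhds
    exact h2.eventually (Metric.ball_mem_nhds x hρ)
  have hdiam : ∀ᶠ ε in 𝓝[>] (0 : ℝ),
      ENNReal.ofReal (ε * lorentzNorm p (v + (2 : ℝ) • w)) < modelDiam K := by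
    unfold modelDiam
    split_ifs with hK
    · have h0 : 0 < π / √(-K) := div_pos pi_pos (sqrt_pos.2 (by linarith))
      have h1 : ContinuousAt (fun ε : ℝ => ε * lorentzNorm p (v + (2 : ℝ) • w)) 0 := by fun_prop
      have h2 : Tendsto (fun ε : ℝ => ε * lorentzNorm p (v + (2 : ℝ) • w)) (𝓝[>] 0) (𝓝 0) := by
        simpa [ContinuousAt] using h1.mono_left nhdsWithin_le_nhds
      filter_upwards [h2.eventually_lt_const h0] with ε hε
      exact (ENNReal.ofReal_lt_ofReal_iff h0).2 hε
    · exact Eventually.of_forall fun _ => ENNReal.ofReal_lt_top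
  have hmod := eventually_exists_isModelMedian K
    (x := (lorentzNorm p (v + (2 : ℝ) • w) + lorentzNorm p v) / 2)
    (y := (lorentzNorm p (v + (2 : ℝ) • w) - lorentzNorm p v) / 2) hwpos (by linarith)
    (by linarith) hupos
  obtain ⟨ε, hε, hx0, hxv, hxc, hd, A, B, C, N, hT, hlt, hgt⟩ :=
    (eventually_mem_nhdsWithin.and ((hlim 0).and ((hlim v).and ((hlim (v + (2 : ℝ) • w)).and
      (hdiam.and hmod))))).exists
  have hε : 0 < ε := hε
  have hseg {y z : Plane} (hy : y ∈ Metric.ball x ρ) (hz : z ∈ Metric.ball x ρ) :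
      MapsTo (AffineMap.lineMap y z : ℝ → Plane) (Icc 0 1) U := fun t ht =>
    hρU ((convex_ball x ρ).lineMap_mem hy hz ht)
  have t1 : v + (2 : ℝ) • w - v = (2 : ℝ) • w := by module
  have t2 : v + (2 : ℝ) • w - (v + w) = w := by module
  have hab : MinkowskiLL (x + ε • (0 : Plane)) (x + ε • v) :=
    minkowskiLL_add_smul hε x (by simpa using hv)
  have hbc : MinkowskiLL (x + ε • v) (x + ε • (v + (2 : ℝ) • w)) :=
    minkowskiLL_add_smul hε x (by simpa [t1, abs_mul] using hw)
  have hac := hab.trans_le hbc.le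
  have tau {a b : Plane} := lpPlane_tau_add_smul hp hε.le x a b
  refine ⟨x + ε • (0 : Plane), x + ε • v, x + ε • (v + (2 : ℝ) • w), AffineMap.lineMap _ _,
    AffineMap.lineMap _ _, AffineMap.lineMap _ _, A, B, C, x + ε • (v + w), N,
    ⟨hab, hbc, isRealizer_lineMap hp hab.le, isRealizer_lineMap hp hbc.le,
      isRealizer_lineMap hp hac.le, hseg hx0 hxv, hseg hxv hxc, hseg hx0 hxc⟩, ?_, ⟨?_, ?_, ?_⟩,
    ⟨1 / 2, by norm_num, ?_⟩, ⟨hT.le_bn, hT.le_nc, ?_, ?_⟩, fun h => ?_, fun h => ?_⟩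
  · rwa [tau, sub_zero]
  · rw [tau, sub_zero]
    refine hT.tau_ab.trans (congrArg _ ?_)
    ring
  · rw [tau, t1, lorentzNorm_smul hp zero_le_two]
    refine hT.tau_bc.trans (congrArg _ ?_)
    ring
  · rw [tau, sub_zero]
    refine hT.tau_ac.trans (congrArg _ ?_)
    ring
  · simp only [AffineMap.lineMap_apply, vsub_eq_sub, vadd_eq_add]
    module
  · rw [tau, add_sub_cancel_left]
    exact hT.tau_bn
  · rw [tau, t2]
    exact hT.tau_nc
  · rw [tau, sub_zero]
    exact hlt (by linarith)
  · rw [tau, sub_zero]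
    exact hgt (by linarith)

theorem lorentzNorm_of_lt {p s t : ℝ} (hp : 0 < p) (h : |t| < s) :
    lorentzNorm p !₂[s, t] = (s ^ p - |t| ^ p) ^ (1 / p) := by
  have hs : 0 < s := (abs_nonneg t).trans_lt h
  have := rpow_le_rpow (abs_nonneg t) h.le hp.le
  simp [lorentzNorm, abs_of_pos hs, this, hs]

/-- The parallelogram identity fails for the vectors `(2, 0)` and `(1, 1 / 2)`, by strict convexity or
concavity of `y ↦ y ^ (2 / p)`. -/
theorem rpow_parallelogram_ne {p : ℝ} (hp : 0 < p) (hp2 : p ≠ 2) :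
    ((3 : ℝ) ^ p - (1 / 2) ^ p) ^ (2 / p) ≠ 8 + ((1 : ℝ) - (1 / 2) ^ p) ^ (2 / p) := by
  set q : ℝ := (1 / 2) ^ p with hq
  set r : ℝ := 3 ^ p with hr
  have hq0 : 0 < q := by positivity
  have hq1 : q < 1 := rpow_lt_one (by norm_num) (by norm_num) hp
  have hr1 : 1 < r := one_lt_rpow (by norm_num) hp
  have h9 : r ^ (2 / p) = 9 := by
    rw [hr, ← rpow_mul (by norm_num), mul_div_cancel₀ _ hp.ne']
    norm_num
  have hd : 0 < r - 1 + q := by linarith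
  -- `1` and `r - q` are convex combinations of `1 - q` and `r` with complementary weights.
  set l := q / (r - 1 + q) with hl
  have hl0 : 0 < l := by positivity
  have hl1 : 0 < 1 - l := by
    rw [hl, sub_pos, div_lt_one hd]
    linarith
  have c1 : (1 - l) * (1 - q) + l * r = 1 := by
    rw [hl]
    field_simp
    ring
  have c2 : l * (1 - q) + (1 - l) * r = r - q := by linarith
  have m1 : 1 - q ∈ Ici (0 : ℝ) := by simp [hq1.le]
  have m2 : r ∈ Ici (0 : ℝ) := by simp; linarith
  have hne : 1 - q ≠ r := by linarith
  rcases lt_or_gt_of_ne hp2 with h | h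
  · have hc := (strictConvexOn_rpow ((one_lt_div hp).2 h)).2 m1 m2 hne
    have i1 := hc hl1 hl0 (by ring)
    have i2 := hc hl0 hl1 (by ring)
    simp only [smul_eq_mul, c1, c2, h9, one_rpow] at i1 i2
    intro e
    linarith
  · have hc := (strictConcaveOn_rpow (by positivity) ((div_lt_one hp).2 h)).2 m1 m2 hne
    have i1 := hc hl1 hl0 (by ring)
    have i2 := hc hl0 hl1 (by ring)
    simp only [smul_eq_mul, c1, c2, h9, one_rpow] at i1 i2
    intro e
    linarith

/-- Replacing the side vectors `v`, `2 • w` of a triangle by `2 • w`, `2 • v` reverses the sign of the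
defect of the parallelogram identity, so that its failure for one parallelogram, at all scales, excludes
both a lower and an upper curvature bound. -/
theorem not_curvBounded_lpPlane {p : ℝ} (hp0 : 0 < p) (hp2 : p ≠ 2) (x : Plane) (K : ℝ) :
    ¬ CurvBoundedBelowAt (lpPlane p) K x ∧ ¬ CurvBoundedAboveAt (lpPlane p) K x := by
  set q : ℝ := (1 / 2) ^ p with hq
  have hq0 : 0 < q := by positivity
  have hq1 : q < 1 := rpow_lt_one (by norm_num) (by norm_num) hp0
  have hr1 : 1 < (3 : ℝ) ^ p := one_lt_rpow (by norm_num) hp0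
  have hpi : 0 < 1 / p := by positivity
  set n := (1 - q) ^ (1 / p) with hn
  set k := ((3 : ℝ) ^ p - q) ^ (1 / p) with hk
  have hn0 : 0 < n := rpow_pos_of_pos (by linarith) _
  have hn1 : n < 1 := rpow_lt_one (by linarith) (by linarith) hpi
  have hk0 : 0 < k := rpow_pos_of_pos (by linarith) _
  have hkn : 3 * n < k := by
    have h3 : ((3 : ℝ) ^ p) ^ (1 / p) = 3 := by
      rw [← rpow_mul (by norm_num), mul_one_div_cancel hp0.ne', rpow_one]
    rw [hn, hk, ← h3, ← mul_rpow (by positivity) (by linarith), h3]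
    exact rpow_lt_rpow (mul_nonneg (by positivity) (by linarith)) (by nlinarith) hpi
  have hne : k ^ 2 ≠ 8 + n ^ 2 := by
    rw [hk, hn, ← rpow_natCast, ← rpow_natCast, ← rpow_mul (by linarith), ← rpow_mul (by linarith)]
    convert rpow_parallelogram_ne hp0 hp2 using 3 <;> (push_cast; ring)
  have habs : |(1 / 2 : ℝ)| = 1 / 2 := abs_of_pos (by norm_num)
  have N1 : lorentzNorm p !₂[1, 1 / 2] = n := by
    rw [lorentzNorm_of_lt hp0 (by rw [habs]; norm_num), one_rpow, habs]
  have N2 : lorentzNorm p !₂[1, -(1 / 2)] = n := by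
    rw [lorentzNorm_of_lt hp0 (by rw [abs_neg, habs]; norm_num), one_rpow, abs_neg, habs]
  have N3 : lorentzNorm p !₂[3, 1 / 2] = k := by
    rw [lorentzNorm_of_lt hp0 (by rw [habs]; norm_num), habs]
  have N4 (t : ℝ) (ht : 0 < t) : lorentzNorm p !₂[t, 0] = t := by
    rw [lorentzNorm_of_lt hp0 (by simpa using ht), abs_zero, zero_rpow hp0.ne', sub_zero,
      ← rpow_mul ht.le, mul_one_div_cancel hp0.ne', rpow_one]
  have s1 : (!₂[1, -(1 / 2)] : Plane) + !₂[1, 1 / 2] = !₂[2, 0] := by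
    ext i
    fin_cases i <;> norm_num
  have s2 : (!₂[1, -(1 / 2)] : Plane) + (2 : ℝ) • !₂[1, 1 / 2] = !₂[3, 1 / 2] := by
    ext i
    fin_cases i <;> norm_num
  have s3 : (2 : ℝ) • (!₂[1, 1 / 2] : Plane) + !₂[1, -(1 / 2)] = !₂[3, 1 / 2] := by
    rw [add_comm, s2]
  have s4 : (2 : ℝ) • (!₂[1, 1 / 2] : Plane) + (2 : ℝ) • !₂[1, -(1 / 2)] = !₂[4, 0] := by
    ext i
    fin_cases i <;> norm_num
  have N5 : lorentzNorm p ((2 : ℝ) • !₂[1, 1 / 2]) = 2 * n := by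
    rw [lorentzNorm_smul hp0 zero_le_two, N1]
  -- The parallelogram spanned by `(1, -1/2)`, `(1, 1/2)` and that of its diagonals have defects of
  -- opposite signs.
  have T1 {U : Set Plane} (hU : U ∈ 𝓝 x) := exists_triangle_of_parallelogram_defect hp0 x K hU
    (v := !₂[1, -(1 / 2)]) (w := !₂[1, 1 / 2]) (by norm_num [abs_lt]) (by norm_num [abs_lt])
    (by rwa [N2]) (by rwa [N1]) (by rw [s1, N4 2 two_pos]; norm_num)
    (by rw [N2, N1, s2, N3]; linarith)
  have T2 {U : Set Plane} (hU : U ∈ 𝓝 x) := exists_triangle_of_parallelogram_defect hp0 x K hU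
    (v := (2 : ℝ) • !₂[1, 1 / 2]) (w := !₂[1, -(1 / 2)]) (by norm_num [abs_lt])
    (by norm_num [abs_lt]) (by rw [N5]; linarith) (by rwa [N2]) (by rwa [s3, N3])
    (by rw [N5, N2, s4, N4 4 (by norm_num)]; linarith)
  rw [s1, s2, N1, N2, N3, N4 2 two_pos] at T1
  rw [s3, s4, N5, N2, N3, N4 4 (by norm_num)] at T2
  constructor
  · rintro ⟨U, hU, h⟩
    rcases lt_or_gt_of_ne hne with hlt | hgt
    · obtain ⟨a, b, c, α, β, γ, A, B, C, M, N, hT, hd, hC, hM, hN, h1, -⟩ := T1 hU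
      exact (h1 (by linarith)).not_ge (h a b c α β γ A B C hT hd hC M hM N hN)
    · obtain ⟨a, b, c, α, β, γ, A, B, C, M, N, hT, hd, hC, hM, hN, h1, -⟩ := T2 hU
      exact (h1 (by linarith)).not_ge (h a b c α β γ A B C hT hd hC M hM N hN)
  · rintro ⟨U, hU, h⟩
    rcases lt_or_gt_of_ne hne with hlt | hgt
    · obtain ⟨a, b, c, α, β, γ, A, B, C, M, N, hT, hd, hC, hM, hN, -, h1⟩ := T2 hU
      exact (h1 (by linarith)).not_ge (h a b c α β γ A B C hT hd hC M hM N hN)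
    · obtain ⟨a, b, c, α, β, γ, A, B, C, M, N, hT, hd, hC, hM, hN, -, h1⟩ := T1 hU
      exact (h1 (by linarith)).not_ge (h a b c α β γ A B C hT hd hC M hM N hN)

theorem mainTheorem3 :
    (∀ p : ℝ, 1 ≤ p → p ≠ 2 → ∀ (x : Plane) (K : ℝ),
      ¬ CurvBoundedBelowAt (lpPlane p) K x ∧ ¬ CurvBoundedAboveAt (lpPlane p) K x) ∧
    (IsTimelikeFlat (lpPlane 2) ∧ IsStronglyTimelikeFlat (lpPlane 2)) ∧
    IsTimelikeFlat lpPlaneInf :=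
  ⟨fun _ hp hp2 x K => not_curvBounded_lpPlane (one_pos.trans_le hp) hp2 x K,
    ⟨isTimelikeFlat_lpPlane_two, isStronglyTimelikeFlat_lpPlane_two⟩, isTimelikeFlat_lpPlaneInf⟩
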